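/- For a prime power $n$, let $\mathbb{F}_n$ be a field with $n$ elements, used also as the index set $[n]$. For $1\le t\le n$ put $$NW_{t,n}=\sum_{f\in\mathbb{F}_n[z],\ \deg f<\lfloor n/(2t)\rfloor}\ \prod_{i\in\mathbb{F}_n}x_{i,f(i)}$$ (with $\deg 0=-\infty$) and $NW_n=\sum_{t=1}^n y_t\cdot NW_{t,n}$, polynomials over a field $\mathbb{F}$ in the variables $x_{i,j}$ ($i,j\in\mathbb{F}_n$) and $y_1,\dots,y_n$. A homogeneous $\Sigma\Pi\Sigma\Pi(r)$ circuit is a depth-four arithmetic circuit over $\mathbb{F}$ (a layered directed acyclic graph: leaves labelled by variables or constants, product gates, sum gates, product gates, and one output sum gate), in which every node computes a homogeneous polynomial and the output gate has fan-in at most $r$; all other fan-ins are unbounded. Its size is its number of nodes. There is an absolute constant $c>0$ such that for every field $\mathbb{F}$ the following hold. (1) The family $\{NW_n\}$, indexed by the prime powers $n$, is in $\mathsf{VNP}$ over $\mathbb{F}$. (2) For every prime power $n$, $NW_n$ has degree $n+1=\Theta(n)$, and exactly $n^2+n=\Theta(n^2)$ variables occur in it. (3) For every prime power $n$ and every $r\ge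 1$, every homogeneous $\Sigma\Pi\Sigma\Pi(r)$ circuit over $\mathbb{F}$ that computes $NW_n$ has size at least $\exp\left(n^{c/r}\log n\right)$. (4) In particular, if $r=r(n)=o(\log n)$, then for every $k$ and all sufficiently large prime powers $n$, every homogeneous $\Sigma\Pi\Sigma\Pi(r(n))$ circuit over $\mathbb{F}$ that computes $NW_n$ has size greater than $n^k$. -/

import Mathlib

universe u v w

open Filter Topology Asymptotics

noncomputable section

/-! ### Arithmetic circuits and the class VNP -/

/-- `StraightLine l` says that `l` lists (latest gate first) the polynomials computed at the nodes
of an arithmetic circuit over the field `F` in the variables `σ`, written in a topological order: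
every node is a variable, a field constant, or a `+` / `×` gate applied to two (possibly equal)
earlier nodes. -/
inductive StraightLine {F : Type u} [Field F] {σ : Type v} : List (MvPolynomial σ F) → Prop
  | nil : StraightLine []
  | var {l : List (MvPolynomial σ F)} (x : σ) :
      StraightLine l → StraightLine (MvPolynomial.X x :: l)
  | const {l : List (MvPolynomial σ F)} (a : F) :
      StraightLine l → StraightLine (MvPolynomial.C a :: l)
  | add {l : List (MvPolynomial σ F)} {p q : MvPolynomial σ F} :
      StraightLine l → p ∈ l → q ∈ l → StraightLine ((p + q) :: l)
  | mul {l : List (MvPolynomial σ F)} {p q : MvPolynomial σ F} :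
      StraightLine l → p ∈ l → q ∈ l → StraightLine ((p * q) :: l)

/-- `p` is computed by an arithmetic circuit (fan-in two) with at most `s` nodes. -/
def HasCircuitOfSize {F : Type u} [Field F] {σ : Type v} (p : MvPolynomial σ F) (s : ℕ) : Prop :=
  ∃ l : List (MvPolynomial σ F), StraightLine l ∧ p ∈ l ∧ l.length ≤ s

/-- The family `(f i)` of polynomials over `F`, where `f i` has index `len i`, is in VNP:
the number of variables and the degree of `f i` are polynomially bounded in `len i`, and
`f i (x) = ∑_{w ∈ {0,1}^(m i)} g i (x, w)` where `m i`, the degree of `g i` and the circuit size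
of `g i` are polynomially bounded in `len i`. -/
def InVNP {F : Type u} [Field F] {ι : Type w} (len : ι → ℕ) {σ : ι → Type v}
    [∀ i, Fintype (σ i)] (f : ∀ i, MvPolynomial (σ i) F) : Prop :=
  ∃ (k : ℕ) (m : ι → ℕ) (g : ∀ i, MvPolynomial (σ i ⊕ Fin (m i)) F), ∀ i,
    Fintype.card (σ i) ≤ len i ^ k + k ∧
    (f i).totalDegree ≤ len i ^ k + k ∧
    m i ≤ len i ^ k + k ∧
    (g i).totalDegree ≤ len i ^ k + k ∧
    HasCircuitOfSize (g i) (len i ^ k + k) ∧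
    f i = ∑ b : Fin (m i) → Bool,
      MvPolynomial.aeval (Sum.elim MvPolynomial.X (fun j => if b j then 1 else 0)) (g i)

/-! ### Depth-four circuits -/

/-- A `ΣΠΣΠ` circuit over `F` in the variables `σ`: a layered directed acyclic graph, with leaves
labelled by variables or field constants, a layer of bottom product gates, a layer of sum gates, a
layer of upper product gates, and one output sum gate.  Gates may be shared, fan-ins are unbounded,
and parallel edges are allowed (the multiset attached to a gate lists its incoming edges). -/
structure SPSPCircuit (F : Type u) (σ : Type v) where
  numLeaves : ℕ
  numBotProds : ℕ
  numSums : ℕ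
  numTopProds : ℕ
  leaf : Fin numLeaves → σ ⊕ F
  botProd : Fin numBotProds → Multiset (Fin numLeaves)
  sumGate : Fin numSums → Multiset (Fin numBotProds)
  topProd : Fin numTopProds → Multiset (Fin numSums)
  output : Multiset (Fin numTopProds)

namespace SPSPCircuit

/-- The number of nodes. -/
def size {F : Type u} {σ : Type v} (C : SPSPCircuit F σ) : ℕ :=
  C.numLeaves + C.numBotProds + C.numSums + C.numTopProds + 1

/-- The fan-in of the output sum gate. -/
def topFanIn {F : Type u} {σ : Type v} (C : SPSPCircuit F σ) : ℕ :=
  Multiset.card C.output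

variable {F : Type u} [Field F] {σ : Type v} (C : SPSPCircuit F σ)

/-- The polynomial at a leaf. -/
def leafVal (i : Fin C.numLeaves) : MvPolynomial σ F :=
  Sum.elim MvPolynomial.X MvPolynomial.C (C.leaf i)

/-- The polynomial computed at a bottom product gate. -/
def botProdVal (i : Fin C.numBotProds) : MvPolynomial σ F :=
  ((C.botProd i).map C.leafVal).prod

/-- The polynomial computed at a sum gate of the middle layer. -/
def sumGateVal (i : Fin C.numSums) : MvPolynomial σ F :=
  ((C.sumGate i).map C.botProdVal).sum

/-- The polynomial computed at an upper product gate. -/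
def topProdVal (i : Fin C.numTopProds) : MvPolynomial σ F :=
  ((C.topProd i).map C.sumGateVal).prod

/-- The polynomial computed by the circuit. -/
def val : MvPolynomial σ F :=
  (C.output.map C.topProdVal).sum

/-- The polynomial computed at every node is homogeneous. -/
def IsHomogeneous : Prop :=
  (∀ i, ∃ d, (C.leafVal i).IsHomogeneous d) ∧
  (∀ i, ∃ d, (C.botProdVal i).IsHomogeneous d) ∧
  (∀ i, ∃ d, (C.sumGateVal i).IsHomogeneous d) ∧
  (∀ i, ∃ d, (C.topProdVal i).IsHomogeneous d) ∧
  ∃ d, C.val.IsHomogeneous d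

end SPSPCircuit

/-! ### Nisan–Wigderson design polynomials -/

/-- The variables `x_{i,j}` (`i, j ∈ K`) and `y_1, …, y_n`, where `n = |K|`; `y_t` is
`Sum.inr (t - 1)`. -/
abbrev NWVar (K : Type v) [Fintype K] : Type v :=
  (K × K) ⊕ Fin (Fintype.card K)

/-- `NW_{t,n} = ∑_f ∏_{i ∈ K} x_{i, f(i)}` over all `f ∈ K[z]` of degree `< ⌊n / (2t)⌋`, where
`n = |K|`.  The zero polynomial has degree `-∞`, so that it is always among the `f`. -/
def NWDesign (F : Type u) [Field F] (K : Type v) [Field K] [Fintype K] (t : ℕ) :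
    MvPolynomial (NWVar K) F :=
  ∑ᶠ (f : Polynomial K) (_ : f.degree < ((Fintype.card K / (2 * t) : ℕ) : WithBot ℕ)),
    ∏ i : K, MvPolynomial.X (Sum.inl (i, f.eval i))

/-- The sum defining `NWDesign` has finitely many terms. -/
theorem finite_setOf_degree_lt (K : Type v) [Field K] [Fintype K] (k : ℕ) :
    {f : Polynomial K | f.degree < (k : WithBot ℕ)}.Finite := by
  have h : Finite (Polynomial.degreeLT K k) :=
    Finite.of_equiv _ (Polynomial.degreeLTEquiv K k).toEquiv.symm
  have h2 : {f : Polynomial K | f.degree < (k : WithBot ℕ)}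
      = (Polynomial.degreeLT K k : Set (Polynomial K)) := by
    ext f
    simp [Polynomial.mem_degreeLT]
  rw [h2]
  exact Set.toFinite _

/-- `NW_n = ∑_{t = 1}^n y_t · NW_{t,n}` where `n = |K|`. -/
def NWPoly (F : Type u) [Field F] (K : Type v) [Field K] [Fintype K] :
    MvPolynomial (NWVar K) F :=
  ∑ t : Fin (Fintype.card K), MvPolynomial.X (Sum.inr t) * NWDesign F K (t.val + 1)

end

noncomputable section

/-! ### Counting monomials -/

/-! Lower bound. A homogeneous circuit of size `s` writes `NW_n`, of degree `d = n + 1`, as a sum of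
at most `r` products of `s`-sparse homogeneous factors. Each product has a threshold degree `D`: the
factors of degree at most `D` carry at least half of `d`, and so do the factors of degree at least
`D`. For derivatives of order `j` this gives two options. If `j * D ≤ d / 8`, they lie in the ideal
generated by the products of all but `j` of the low factors. If `j ≤ d / 8`, the at most `d / D`
high factors can be expanded into at most `s ^ (d / D)` monomials of degree at least `d / 2`, of
which each derivative destroys at most one degree. In both options the generators have degree at
least about `3d/8`, and there are few of them when `D` is small, respectively large, compared with
`d / j` (`exists_threshold`). By pigeonhole a scale can be chosen that the at most `r` thresholds
avoid (`exists_avoided_scale`), so every product falls clearly on one side, and all derivatives of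
`NW_n` of order `k + 1` lie in an ideal with few generators of high degree.

The `y_t` make one polynomial hard at every scale. With `k = ⌊n/(2t)⌋`, differentiating by `y_t` and
by `x_{i,f(i)}` for `k` fixed points `i` leaves a single monomial, since `k` values determine `f`
(`iterDeriv_nwPoly`). The ideal thus contains `n ^ k` squarefree monomials of degree `n - k`, any
two sharing fewer than `k` variables. A Bonferroni count bounds below the monomials of degree `n - k
+ l` in the ideal (`card_multiples_ge`); the dimension of that graded piece bounds them above
(`card_monomials_le_of_mem_span`). For a suitable `l` the two force `n ^ k ≤ 128 * b ^ 4` for the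
number `b` of generators (`pow_le_of_derivsInSmallIdeal`), which contradicts a small `s`. Only
squarefree monomials are differentiated explicitly, so the characteristic is irrelevant.

Membership in `VNP`. The witness encodes the coefficients of `f` one-hot. Arithmetic of the index
field is not available over `F`, so `f(i)` is followed by indicator tables of its partial sums
(`hornerIndicator`). -/

theorem succ_mul_multichoose (N j : ℕ) :
    (j + 1) * Nat.multichoose N (j + 1) = (N + j) * Nat.multichoose N j := by
  rcases N with _ | N
  · rcases j with _ | j <;> simp
  · rw [Nat.multichoose_eq, Nat.multichoose_eq]
    have h := Nat.add_one_mul_choose_eq (N + j) j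
    have e1 : N + 1 + (j + 1) - 1 = N + j + 1 := by omega
    have e2 : N + 1 + j - 1 = N + j := by omega
    rw [e1, e2, show N + 1 + j = N + j + 1 by ring, h, mul_comm]

theorem multichoose_le_succ {N : ℕ} (hN : 1 ≤ N) (j : ℕ) :
    Nat.multichoose N j ≤ Nat.multichoose N (j + 1) := by
  have h := succ_mul_multichoose N j
  have : (j + 1) * Nat.multichoose N j ≤ (j + 1) * Nat.multichoose N (j + 1) := by
    rw [h]; exact Nat.mul_le_mul_right _ (by omega)
  exact Nat.le_of_mul_le_mul_left this (by omega)

theorem multichoose_mono {N : ℕ} (hN : 1 ≤ N) : Monotone (Nat.multichoose N) :=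
  monotone_nat_of_le_succ (multichoose_le_succ hN)

/-- Consecutive values have ratio `1 + (N - 1) / (j + 1)`, decreasing in `j`. Above `l` every ratio
is at most the one at `l`; below `l`, in `multichoose_sub_mul_le`, every ratio is at least the last
one before `l`. -/
theorem multichoose_add_le {N l : ℕ} (hN : 1 ≤ N) (j : ℕ) :
    (Nat.multichoose N (l + j) : ℝ) ≤
      Nat.multichoose N l * (1 + ((N : ℝ) - 1) / (l + 1)) ^ j := by
  have hN' : (0 : ℝ) ≤ (N : ℝ) - 1 := by
    have : (1 : ℝ) ≤ N := by exact_mod_cast hN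
    linarith
  induction j with
  | zero => simp
  | succ j ih =>
    have h : ((l + j : ℕ) + 1 : ℝ) * Nat.multichoose N (l + j + 1) =
        ((N : ℝ) + (l + j : ℕ)) * Nat.multichoose N (l + j) := by
      exact_mod_cast succ_mul_multichoose N (l + j)
    have hpos : (0 : ℝ) < (l + j : ℕ) + 1 := by positivity
    have h2 : (Nat.multichoose N (l + j + 1) : ℝ) =
        (1 + ((N : ℝ) - 1) / ((l + j : ℕ) + 1)) * Nat.multichoose N (l + j) := by
      field_simp
      linarith
    have h3 : (1 + ((N : ℝ) - 1) / ((l + j : ℕ) + 1)) ≤ (1 + ((N : ℝ) - 1) / (l + 1)) := by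
      gcongr
      simp
    rw [← add_assoc, h2, pow_succ]
    calc _ ≤ (1 + ((N : ℝ) - 1) / (l + 1)) *
        (Nat.multichoose N l * (1 + ((N : ℝ) - 1) / (l + 1)) ^ j) := by gcongr
      _ = _ := by ring

theorem multichoose_sub_mul_le {N l : ℕ} (hN : 1 ≤ N) (hl : 1 ≤ l) {d : ℕ} (hd : d ≤ l) :
    (Nat.multichoose N (l - d) : ℝ) * (1 + ((N : ℝ) - 1) / l) ^ d ≤ Nat.multichoose N l := by
  have hN' : (0 : ℝ) ≤ (N : ℝ) - 1 := by
    have : (1 : ℝ) ≤ N := by exact_mod_cast hN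
    linarith
  have hl' : (0 : ℝ) < l := by exact_mod_cast hl
  induction d with
  | zero => simp
  | succ d ih =>
    obtain ⟨i, hi⟩ : ∃ i, l - d = i + 1 := ⟨l - d - 1, by omega⟩
    have hi' : l - (d + 1) = i := by omega
    have ih' := ih (by omega)
    rw [hi] at ih'
    rw [hi']
    have h : ((i : ℝ) + 1) * Nat.multichoose N (i + 1) =
        ((N : ℝ) + i) * Nat.multichoose N i := by
      exact_mod_cast succ_mul_multichoose N i
    have h2 : (Nat.multichoose N (i + 1) : ℝ) =
        (1 + ((N : ℝ) - 1) / (i + 1)) * Nat.multichoose N i := by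
      field_simp
      linarith
    have hil : (i : ℝ) + 1 ≤ l := by
      have : i + 1 ≤ l := by omega
      exact_mod_cast this
    have h3 : (1 + ((N : ℝ) - 1) / l) ≤ (1 + ((N : ℝ) - 1) / (i + 1)) := by
      gcongr
    calc _ = (1 + ((N : ℝ) - 1) / l) * Nat.multichoose N i * (1 + ((N : ℝ) - 1) / l) ^ d := by
          ring
      _ ≤ Nat.multichoose N (i + 1) * (1 + ((N : ℝ) - 1) / l) ^ d := by
          rw [h2]; gcongr
      _ ≤ _ := ih'

open scoped Classical in
/-- The exponent vectors of total degree `e`. -/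
def exponents (σ : Type v) [Fintype σ] (e : ℕ) : Finset (σ →₀ ℕ) :=
  Finset.univ.finsuppAntidiag e

theorem mem_exponents {σ : Type v} [Fintype σ] {e : ℕ} {γ : σ →₀ ℕ} :
    γ ∈ exponents σ e ↔ γ.degree = e := by
  classical
  simp [exponents, Finsupp.degree_eq_sum]

theorem card_exponents (σ : Type v) [Fintype σ] (e : ℕ) :
    (exponents σ e).card = Nat.multichoose (Fintype.card σ) e := by
  classical
  rw [exponents, Finset.card_finsuppAntidiag_nat_eq_multichoose, Finset.card_univ]

/-- The exponent vector of the squarefree monomial with variables `B`. -/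
def sqfreeExp {σ : Type v} (B : Finset σ) : σ →₀ ℕ := ∑ v ∈ B, Finsupp.single v 1

theorem sqfreeExp_apply {σ : Type v} [DecidableEq σ] (B : Finset σ) (v : σ) :
    sqfreeExp B v = if v ∈ B then 1 else 0 := by
  simp [sqfreeExp, Finsupp.finsetSum_apply, Finsupp.single_apply]

theorem degree_sqfreeExp {σ : Type v} (B : Finset σ) : (sqfreeExp B).degree = B.card := by
  simp [sqfreeExp]

theorem sqfreeExp_le_iff {σ : Type v} {B : Finset σ} {γ : σ →₀ ℕ} :
    sqfreeExp B ≤ γ ↔ ∀ v ∈ B, 1 ≤ γ v := by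
  classical
  rw [Finsupp.le_def]
  refine ⟨fun h v hv => by simpa [sqfreeExp_apply, hv] using h v, fun h v => ?_⟩
  rw [sqfreeExp_apply]
  split_ifs with hv
  · exact h v hv
  · exact Nat.zero_le _

open scoped Classical in
theorem card_filter_exponents {σ : Type v} [Fintype σ] {e : ℕ} {B : Finset σ} (h : B.card ≤ e) :
    ((exponents σ e).filter (fun γ => sqfreeExp B ≤ γ)).card =
      Nat.multichoose (Fintype.card σ) (e - B.card) := by
  rw [← card_exponents]
  symm
  refine Finset.card_bij (fun γ _ => γ + sqfreeExp B) ?_ ?_ ?_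
  · intro γ hγ
    rw [mem_exponents] at hγ
    rw [Finset.mem_filter, mem_exponents]
    refine ⟨?_, le_add_self⟩
    rw [map_add, hγ, degree_sqfreeExp]
    omega
  · intro a _ b _ hab
    exact add_right_cancel hab
  · intro γ hγ
    rw [Finset.mem_filter, mem_exponents] at hγ
    refine ⟨γ - sqfreeExp B, ?_, tsub_add_cancel_of_le hγ.2⟩
    rw [mem_exponents]
    have : (γ - sqfreeExp B).degree + (sqfreeExp B).degree = γ.degree := by
      rw [← map_add, tsub_add_cancel_of_le hγ.2]
    rw [degree_sqfreeExp, hγ.1] at this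
    omega

open scoped Classical in
theorem filter_exponents_eq_empty {σ : Type v} [Fintype σ] {e : ℕ} {B : Finset σ}
    (h : e < B.card) : (exponents σ e).filter (fun γ => sqfreeExp B ≤ γ) = ∅ := by
  rw [Finset.filter_eq_empty_iff]
  intro γ hγ hle
  rw [mem_exponents] at hγ
  have := Finsupp.degree_mono hle
  rw [degree_sqfreeExp] at this
  omega

/-- A Bonferroni inequality: `2 ∑ |A_i| - ∑ |A_i ∩ A_j| ≤ |⋃ A_i|`. -/
theorem two_mul_sum_card_le {ι α : Type*} [DecidableEq α] (s : Finset ι) (A : ι → Finset α) :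
    2 * ∑ i ∈ s, (A i).card ≤
      (s.biUnion A).card + ∑ i ∈ s, ∑ j ∈ s, (A i ∩ A j).card := by
  set U := s.biUnion A with hU
  have hsub : ∀ i ∈ s, A i ⊆ U := fun i hi => Finset.subset_biUnion_of_mem A hi
  have h1 : ∀ B ⊆ U, B.card = ∑ x ∈ U, if x ∈ B then 1 else 0 := by
    intro B hB
    rw [← Finset.sum_filter, Finset.card_eq_sum_ones, Finset.filter_mem_eq_inter,
      Finset.inter_eq_right.mpr hB]
  have e1 : ∑ i ∈ s, (A i).card = ∑ x ∈ U, ∑ i ∈ s, (if x ∈ A i then 1 else 0) := by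
    rw [Finset.sum_comm]
    exact Finset.sum_congr rfl fun i hi => h1 _ (hsub i hi)
  have e2 : ∑ i ∈ s, ∑ j ∈ s, (A i ∩ A j).card =
      ∑ x ∈ U, (∑ i ∈ s, (if x ∈ A i then 1 else 0)) * (∑ j ∈ s, (if x ∈ A j then 1 else 0)) := by
    simp_rw [Finset.sum_mul_sum]
    rw [Finset.sum_comm (s := U)]
    refine Finset.sum_congr rfl fun i hi => ?_
    rw [Finset.sum_comm (s := U)]
    refine Finset.sum_congr rfl fun j hj => ?_
    rw [h1 _ (Finset.inter_subset_left.trans (hsub i hi))]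
    refine Finset.sum_congr rfl fun x _ => ?_
    by_cases h : x ∈ A i <;> by_cases h' : x ∈ A j <;> simp [h, h']
  rw [e1, e2, Finset.card_eq_sum_ones, ← Finset.sum_add_distrib, Finset.mul_sum]
  -- For a point lying in `m` of the sets the claim is `2 * m ≤ 1 + m ^ 2`. The double sum runs over
  -- ordered pairs and includes the diagonal.
  refine Finset.sum_le_sum fun x _ => ?_
  generalize (∑ i ∈ s, if x ∈ A i then 1 else 0) = m
  nlinarith [sq_nonneg ((m : ℤ) - 1), sq_nonneg (m - 1)]

open scoped Classical in
/-- The number of degree-`e` multiples of squarefree monomials that pairwise differ in many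
variables. -/
theorem card_multiples_ge {σ : Type v} [Fintype σ] [DecidableEq σ] {ι : Type*} (s : Finset ι)
    (B : ι → Finset σ) {b g l : ℕ} (hcard : ∀ i ∈ s, (B i).card = b)
    (hunion : ∀ i ∈ s, ∀ j ∈ s, i ≠ j → b + g ≤ (B i ∪ B j).card) (hl : 1 ≤ l)
    (hσ : 1 ≤ Fintype.card σ)
    (hg : (2 * s.card : ℝ) ≤ (1 + ((Fintype.card σ : ℝ) - 1) / l) ^ g) :
    (s.card : ℝ) * Nat.multichoose (Fintype.card σ) l / 2 ≤
      (((exponents σ (b + l)).filter (fun γ => ∃ i ∈ s, sqfreeExp (B i) ≤ γ)).card : ℝ) := by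
  set N := Fintype.card σ
  set A : ι → Finset (σ →₀ ℕ) := fun i => (exponents σ (b + l)).filter (fun γ => sqfreeExp (B i) ≤ γ)
  have hA : ∀ i ∈ s, (A i).card = Nat.multichoose N l := by
    intro i hi
    have := card_filter_exponents (σ := σ) (e := b + l) (B := B i) (by rw [hcard i hi]; omega)
    rw [hcard i hi, Nat.add_sub_cancel_left] at this
    exact this
  have hU : s.biUnion A = (exponents σ (b + l)).filter (fun γ => ∃ i ∈ s, sqfreeExp (B i) ≤ γ) := by
    ext γ
    simp only [Finset.mem_biUnion, Finset.mem_filter, A]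
    tauto
  -- A common multiple is a multiple of the lcm, whose degree is at least `b + g`. This costs `g`
  -- degrees, hence a factor of at least `2 * s.card` by `hg`.
  have hint : ∀ i ∈ s, ∀ j ∈ s, i ≠ j →
      (2 * s.card : ℝ) * (A i ∩ A j).card ≤ Nat.multichoose N l := by
    intro i hi j hj hij
    have hsub : A i ∩ A j ⊆ (exponents σ (b + l)).filter (fun γ => sqfreeExp (B i ∪ B j) ≤ γ) := by
      intro γ hγ
      simp only [Finset.mem_inter, Finset.mem_filter, A] at hγ
      rw [Finset.mem_filter]
      refine ⟨hγ.1.1, ?_⟩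
      have h1 := sqfreeExp_le_iff.mp hγ.1.2
      have h2 := sqfreeExp_le_iff.mp hγ.2.2
      rw [sqfreeExp_le_iff]
      intro v hv
      rcases Finset.mem_union.mp hv with hv | hv
      · exact h1 v hv
      · exact h2 v hv
    have hu := hunion i hi j hj hij
    by_cases hle : (B i ∪ B j).card ≤ b + l
    · have h1 : (A i ∩ A j).card ≤ Nat.multichoose N (l - g) := by
        refine (Finset.card_le_card hsub).trans ?_
        rw [card_filter_exponents hle]
        exact multichoose_mono hσ (by omega)
      calc (2 * s.card : ℝ) * (A i ∩ A j).card
          ≤ (1 + ((N : ℝ) - 1) / l) ^ g * Nat.multichoose N (l - g) := by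
            gcongr
            exact le_trans (by positivity) hg
        _ ≤ _ := by
            rw [mul_comm]
            exact multichoose_sub_mul_le hσ hl (by omega)
    · have h0 : A i ∩ A j = ∅ := by
        rw [← Finset.subset_empty, ← filter_exponents_eq_empty (not_le.mp hle)]
        exact hsub
      rw [h0]
      simp
  have hB := two_mul_sum_card_le s A
  rw [hU, Finset.sum_congr rfl hA, Finset.sum_const, smul_eq_mul] at hB
  -- The diagonal contributes `1` and the other terms together at most `1/2`, in units of
  -- `multichoose N l`. Bonferroni then leaves `2 - 3/2 = 1/2` per set.
  have hpair : ∀ i ∈ s, (∑ j ∈ s, ((A i ∩ A j).card : ℝ)) ≤ 3 / 2 * Nat.multichoose N l := by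
    intro i hi
    rw [← Finset.add_sum_erase s _ hi, Finset.inter_self, hA i hi]
    have hs : (0 : ℝ) < s.card := by exact_mod_cast Finset.card_pos.mpr ⟨i, hi⟩
    have : ∑ j ∈ s.erase i, ((A i ∩ A j).card : ℝ) ≤
        ∑ j ∈ s.erase i, (Nat.multichoose N l : ℝ) / (2 * s.card) := by
      refine Finset.sum_le_sum fun j hj => ?_
      rw [le_div_iff₀ (by positivity), mul_comm]
      exact hint i hi j (Finset.mem_of_mem_erase hj) (Finset.ne_of_mem_erase hj).symm
    have h2 : ∑ j ∈ s.erase i, (Nat.multichoose N l : ℝ) / (2 * s.card) ≤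
        Nat.multichoose N l / 2 := by
      rw [Finset.sum_const, nsmul_eq_mul]
      have hc : ((s.erase i).card : ℝ) ≤ s.card := by
        exact_mod_cast Finset.card_le_card (Finset.erase_subset _ _)
      calc _ ≤ (s.card : ℝ) * (Nat.multichoose N l / (2 * s.card)) := by gcongr
        _ = _ := by field_simp
    linarith
  have hsum := Finset.sum_le_sum hpair
  rw [Finset.sum_const, nsmul_eq_mul] at hsum
  have hB' : 2 * ((s.card : ℝ) * Nat.multichoose N l) ≤
      (((exponents σ (b + l)).filter (fun γ => ∃ i ∈ s, sqfreeExp (B i) ≤ γ)).card : ℝ) +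
      ∑ i ∈ s, ∑ j ∈ s, ((A i ∩ A j).card : ℝ) := by exact_mod_cast hB
  linarith

/-! ### The graded pieces of an ideal -/

open MvPolynomial in
/-- An ideal generated by few homogeneous polynomials of high degree has few monomials in each
degree. -/
theorem card_monomials_le_of_mem_span {F : Type u} [Field F] {σ : Type v} [Fintype σ]
    (hσ : 1 ≤ Fintype.card σ) (G : Finset (MvPolynomial σ F)) {δ e : ℕ}
    (hG : ∀ p ∈ G, ∃ d, δ ≤ d ∧ p.IsHomogeneous d) (S : Finset (σ →₀ ℕ))
    (hS : ∀ γ ∈ S, γ.degree = e ∧ monomial γ (1 : F) ∈ Ideal.span (G : Set (MvPolynomial σ F))) :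
    S.card ≤ G.card * Nat.multichoose (Fintype.card σ) (e - δ) := by
  classical
  choose! d hd hhom using hG
  -- The degree-`e` part of the ideal is spanned by the multiples of generators by monomials of
  -- complementary degree. Distinct monomials are independent, so the number of spanning elements
  -- bounds `S.card`.
  set E : MvPolynomial σ F → Finset (σ →₀ ℕ) :=
    fun p => if d p ≤ e then exponents σ (e - d p) else ∅
  set 𝒱 : Finset (MvPolynomial σ F) := G.biUnion fun p => (E p).image fun α => monomial α 1 * p
  have hcard : 𝒱.card ≤ G.card * Nat.multichoose (Fintype.card σ) (e - δ) := by
    refine Finset.card_biUnion_le_card_mul _ _ _ fun p hp => Finset.card_image_le.trans ?_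
    simp only [E]
    split_ifs with h
    · rw [card_exponents]
      exact multichoose_mono hσ (by have := hd p hp; omega)
    · simp
  have hmem : ∀ γ ∈ S, monomial γ (1 : F) ∈ Submodule.span F (𝒱 : Set (MvPolynomial σ F)) := by
    intro γ hγ
    obtain ⟨hdeg, hspan⟩ := hS γ hγ
    obtain ⟨f, -, hf⟩ := Submodule.mem_span_finset.mp hspan
    have hself : homogeneousComponent e (monomial γ (1 : F)) = monomial γ 1 :=
      homogeneousComponent_eq_self (isHomogeneous_monomial _ hdeg)
    rw [← hself, ← hf, map_sum]
    refine Submodule.sum_mem _ fun p hp => ?_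
    have hexp : f p • p = ∑ α ∈ (f p).support, (coeff α (f p)) • (monomial α (1 : F) * p) := by
      conv_lhs => rw [(f p).as_sum]
      rw [smul_eq_mul, Finset.sum_mul]
      refine Finset.sum_congr rfl fun α _ => ?_
      rw [← smul_mul_assoc, smul_monomial, smul_eq_mul, mul_one]
    rw [hexp, map_sum]
    refine Submodule.sum_mem _ fun α _ => ?_
    rw [map_smul]
    refine Submodule.smul_mem _ _ ?_
    have hh : (monomial α (1 : F) * p).IsHomogeneous (α.degree + d p) :=
      (isHomogeneous_monomial _ rfl).mul (hhom p hp)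
    rw [homogeneousComponent_of_mem hh]
    split_ifs with h
    · refine Submodule.subset_span ?_
      simp only [𝒱, Finset.coe_biUnion, Set.mem_iUnion, Finset.coe_image]
      refine ⟨p, hp, α, ?_, rfl⟩
      simp only [E]
      rw [if_pos (by omega), Finset.mem_coe, mem_exponents]
      omega
    · exact Submodule.zero_mem _
  have hli : LinearIndependent F (fun γ : S => (monomial γ.1 (1 : F) : MvPolynomial σ F)) := by
    have := (basisMonomials σ F).linearIndependent
    rw [coe_basisMonomials] at this
    exact this.comp (fun γ : S => γ.1) Subtype.val_injective
  have hle : Submodule.span F (Set.range fun γ : S => (monomial γ.1 (1 : F) : MvPolynomial σ F)) ≤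
      Submodule.span F (𝒱 : Set (MvPolynomial σ F)) := by
    rw [Submodule.span_le]
    rintro _ ⟨γ, rfl⟩
    exact hmem γ.1 γ.2
  have h1 := finrank_span_eq_card hli
  have h2 := Submodule.finrank_mono hle
  have h3 := finrank_span_finset_le_card (R := F) 𝒱
  rw [h1, Fintype.card_coe] at h2
  exact h2.trans (h3.trans hcard)

/-! ### Derivatives of products -/

section Derivatives

open MvPolynomial

variable {F : Type u} [Field F] {σ : Type v}

/-- The iterated partial derivative along a list of variables. -/
def iterDeriv : List σ → MvPolynomial σ F →ₗ[F] MvPolynomial σ F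
  | [] => LinearMap.id
  | v :: V => (pderiv v).toLinearMap ∘ₗ iterDeriv V

/-- The ideal generated by the products of `m` of the factors `G`. -/
def prodIdeal (G : Multiset (MvPolynomial σ F)) (m : ℕ) : Ideal (MvPolynomial σ F) :=
  Ideal.span {p | ∃ U ≤ G, Multiset.card U = m ∧ U.prod = p}

theorem prodIdeal_mono {G G' : Multiset (MvPolynomial σ F)} (h : G ≤ G') (m : ℕ) :
    prodIdeal G m ≤ prodIdeal G' m :=
  Ideal.span_mono fun _ ⟨U, hU, hc, hp⟩ => ⟨U, hU.trans h, hc, hp⟩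

theorem prod_mem_prodIdeal {U G : Multiset (MvPolynomial σ F)} (h : U ≤ G) :
    U.prod ∈ prodIdeal G (Multiset.card U) :=
  Ideal.subset_span ⟨U, h, rfl, rfl⟩

theorem mul_mem_prodIdeal_cons {G : Multiset (MvPolynomial σ F)} {m : ℕ}
    (a : MvPolynomial σ F) {p : MvPolynomial σ F} (hp : p ∈ prodIdeal G m) :
    a * p ∈ prodIdeal (a ::ₘ G) (m + 1) := by
  refine Submodule.span_induction ?_ ?_ ?_ ?_ hp
  · rintro _ ⟨U, hU, hc, rfl⟩
    rw [← Multiset.prod_cons]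
    exact Ideal.subset_span ⟨a ::ₘ U, Multiset.cons_le_cons a hU, by simp [hc], rfl⟩
  · simp
  · intro x y _ _ hx hy
    rw [mul_add]
    exact Ideal.add_mem _ hx hy
  · intro c x _ hx
    rw [smul_eq_mul, mul_left_comm]
    exact Ideal.mul_mem_left _ _ hx

theorem pderiv_prod_mem_prodIdeal (v : σ) (U : Multiset (MvPolynomial σ F)) :
    pderiv v U.prod ∈ prodIdeal U (Multiset.card U - 1) := by
  induction U using Multiset.induction_on with
  | empty => simp
  | cons a U ih =>
    rw [Multiset.prod_cons, pderiv_mul, Multiset.card_cons, Nat.add_sub_cancel]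
    refine Ideal.add_mem _ (Ideal.mul_mem_left _ _
      (prod_mem_prodIdeal (Multiset.le_cons_self U a))) ?_
    rcases Nat.eq_zero_or_pos (Multiset.card U) with h | h
    · rw [Multiset.card_eq_zero] at h
      simp [h]
    · have := mul_mem_prodIdeal_cons a ih
      rwa [Nat.sub_add_cancel h] at this

/-- By the product rule a derivative destroys at most one factor of a product; when it hits the
cofactor, the product survives whole. -/
theorem pderiv_mem_prodIdeal (v : σ) {G : Multiset (MvPolynomial σ F)} {m : ℕ}
    {p : MvPolynomial σ F} (hp : p ∈ prodIdeal G (m + 1)) : pderiv v p ∈ prodIdeal G m := by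
  have hle : prodIdeal G (m + 1) ≤ prodIdeal G m := by
    refine Ideal.span_le.mpr ?_
    rintro _ ⟨U, hU, hc, rfl⟩
    obtain ⟨a, ha⟩ := Multiset.card_pos_iff_exists_mem.mp (by omega : 0 < Multiset.card U)
    obtain ⟨U', rfl⟩ := Multiset.exists_cons_of_mem ha
    rw [Multiset.prod_cons]
    refine Ideal.mul_mem_left _ _ (Ideal.subset_span
      ⟨U', (Multiset.le_cons_self U' a).trans hU, by simpa using hc, rfl⟩)
  refine Submodule.span_induction ?_ ?_ ?_ ?_ hp
  · rintro _ ⟨U, hU, hc, rfl⟩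
    have := prodIdeal_mono hU _ (pderiv_prod_mem_prodIdeal v U)
    rwa [hc] at this
  · simp
  · intro x y _ _ hx hy
    rw [map_add]
    exact Ideal.add_mem _ hx hy
  · intro c x hx hx'
    rw [smul_eq_mul, pderiv_mul]
    exact Ideal.add_mem _ (Ideal.mul_mem_left _ _ (hle hx)) (Ideal.mul_mem_left _ _ hx')

theorem iterDeriv_mem_prodIdeal {G : Multiset (MvPolynomial σ F)} {m : ℕ} (V : List σ)
    {p : MvPolynomial σ F} (hp : p ∈ prodIdeal G (m + V.length)) :
    iterDeriv V p ∈ prodIdeal G m := by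
  induction V generalizing m with
  | nil => exact hp
  | cons v V ih =>
    refine pderiv_mem_prodIdeal v (ih ?_)
    rwa [List.length_cons, add_comm V.length 1, ← add_assoc] at hp

/-- `T` has derivatives of order `j` in an ideal generated by at most `b` homogeneous polynomials
of degree at least `δ`. -/
def DerivsInSmallIdeal (T : MvPolynomial σ F) (j b δ : ℕ) : Prop :=
  ∃ 𝒰 : Finset (MvPolynomial σ F), 𝒰.card ≤ b ∧
    (∀ p ∈ 𝒰, ∃ d, δ ≤ d ∧ p.IsHomogeneous d) ∧
    ∀ V : List σ, V.length = j → iterDeriv V T ∈ Ideal.span (𝒰 : Set (MvPolynomial σ F))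

theorem DerivsInSmallIdeal.mono {T : MvPolynomial σ F} {j b b' δ : ℕ}
    (h : DerivsInSmallIdeal T j b δ) (hb : b ≤ b') : DerivsInSmallIdeal T j b' δ := by
  obtain ⟨𝒰, h1, h2⟩ := h
  exact ⟨𝒰, h1.trans hb, h2⟩

theorem DerivsInSmallIdeal.sum {ι : Type*} (s : Finset ι) (T : ι → MvPolynomial σ F) {j b δ : ℕ}
    (h : ∀ i ∈ s, DerivsInSmallIdeal (T i) j b δ) :
    DerivsInSmallIdeal (∑ i ∈ s, T i) j (s.card * b) δ := by
  classical
  choose! 𝒰 h1 h2 h3 using h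
  refine ⟨s.biUnion 𝒰, Finset.card_biUnion_le_card_mul _ _ _ h1, ?_, ?_⟩
  · intro p hp
    obtain ⟨i, hi, hp⟩ := Finset.mem_biUnion.mp hp
    exact h2 i hi p hp
  · intro V hV
    rw [map_sum]
    refine Ideal.sum_mem _ fun i hi => ?_
    refine Ideal.span_mono ?_ (h3 i hi V hV)
    exact_mod_cast Finset.subset_biUnion_of_mem 𝒰 hi

/-- The generators are the products of all but `j` factors of `G`. The cofactor `R` is arbitrary,
because it is absorbed by the ideal. -/
theorem derivsInSmallIdeal_prod_mul (G : Multiset (MvPolynomial σ F)) (R : MvPolynomial σ F)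
    {d j δ : ℕ} (hj : j ≤ Multiset.card G) (hd : Multiset.card G ≤ d)
    (hδ : ∀ U ≤ G, Multiset.card U = Multiset.card G - j → ∃ d, δ ≤ d ∧ U.prod.IsHomogeneous d) :
    DerivsInSmallIdeal (G.prod * R) j (d.choose j) δ := by
  classical
  refine ⟨((G.powersetCard (Multiset.card G - j)).map Multiset.prod).toFinset, ?_, ?_, ?_⟩
  · refine (Multiset.toFinset_card_le _).trans ?_
    rw [Multiset.card_map, Multiset.card_powersetCard, Nat.choose_symm hj]
    exact Nat.choose_le_choose j hd
  · intro p hp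
    rw [Multiset.mem_toFinset, Multiset.mem_map] at hp
    obtain ⟨U, hU, rfl⟩ := hp
    rw [Multiset.mem_powersetCard] at hU
    exact hδ U hU.1 hU.2
  · intro V hV
    have h : G.prod * R ∈ prodIdeal G (Multiset.card G - j + V.length) := by
      rw [hV, Nat.sub_add_cancel hj]
      exact Ideal.mul_mem_right _ _ (prod_mem_prodIdeal le_rfl)
    refine Ideal.span_mono ?_ (iterDeriv_mem_prodIdeal V h)
    rintro _ ⟨U, hU, hc, rfl⟩
    rw [Finset.mem_coe, Multiset.mem_toFinset, Multiset.mem_map]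
    exact ⟨U, Multiset.mem_powersetCard.mpr ⟨hU, hc⟩, rfl⟩

/-! ### Products of sparse homogeneous polynomials -/

theorem isHomogeneous_multiset_prod (U : Multiset (MvPolynomial σ F))
    (h : ∀ q ∈ U, q.IsHomogeneous q.totalDegree) :
    U.prod.IsHomogeneous (U.map totalDegree).sum := by
  induction U using Multiset.induction_on with
  | empty => simpa using isHomogeneous_one σ F
  | cons a U ih =>
    rw [Multiset.prod_cons, Multiset.map_cons, Multiset.sum_cons]
    exact (h a (Multiset.mem_cons_self a U)).mul
      (ih fun q hq => h q (Multiset.mem_cons_of_mem hq))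

theorem card_support_multiset_prod_le {s : ℕ} (U : Multiset (MvPolynomial σ F))
    (h : ∀ q ∈ U, q.support.card ≤ s) : U.prod.support.card ≤ s ^ Multiset.card U := by
  classical
  induction U using Multiset.induction_on with
  | empty =>
    rw [Multiset.prod_zero, Multiset.card_zero, pow_zero]
    exact (Finset.card_le_card (support_monomial_subset (s := 0) (a := (1 : F)))).trans (by simp)
  | cons a U ih =>
    rw [Multiset.prod_cons, Multiset.card_cons, pow_succ']
    refine (Finset.card_le_card (support_mul a U.prod)).trans (Finset.card_add_le.trans ?_)
    exact Nat.mul_le_mul (h a (Multiset.mem_cons_self a U))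
      (ih fun q hq => h q (Multiset.mem_cons_of_mem hq))

theorem multiset_sum_map_filter {α : Type*} (P : α → Prop) [DecidablePred P] (f : α → ℕ)
    (U : Multiset α) :
    ((U.filter P).map f).sum = (U.map fun q => if P q then f q else 0).sum := by
  induction U using Multiset.induction_on with
  | empty => simp
  | cons a U ih =>
    by_cases h : P a <;> simp [h, ih]

/-- A product of the variables and a further factor. -/
theorem derivsInSmallIdeal_monomial_mul (a : σ →₀ ℕ) (R : MvPolynomial σ F) {d j δ : ℕ}
    (had : a.degree ≤ d) (hδ : δ + j ≤ a.degree) :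
    DerivsInSmallIdeal (monomial a 1 * R) j (d.choose j) δ := by
  have hprod : monomial a (1 : F) = (a.toMultiset.map X).prod := by
    rw [monomial_eq, C_1, one_mul, Finsupp.toMultiset_map, Finsupp.prod_toMultiset,
      Finsupp.prod_mapDomain_index (fun _ => pow_zero _) (fun _ _ _ => pow_add _ _ _)]
  have hcard : Multiset.card (a.toMultiset.map (X : σ → MvPolynomial σ F)) = a.degree := by
    rw [Multiset.card_map, Finsupp.card_toMultiset, Finsupp.degree_apply, Finsupp.sum]
    rfl
  rw [hprod]
  refine derivsInSmallIdeal_prod_mul _ R (by omega) (by omega) ?_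
  intro U hU hc
  refine ⟨Multiset.card U, by omega, ?_⟩
  have hX : ∀ q ∈ U, q.IsHomogeneous 1 := by
    intro q hq
    obtain ⟨v, -, rfl⟩ := Multiset.mem_map.mp (Multiset.mem_of_le hU hq)
    exact isHomogeneous_X F v
  clear hc hU
  induction U using Multiset.induction_on with
  | empty => simpa using isHomogeneous_one σ F
  | cons a U ih =>
    rw [Multiset.prod_cons, Multiset.card_cons, add_comm]
    exact (hX a (Multiset.mem_cons_self a U)).mul
      (ih fun q hq => hX q (Multiset.mem_cons_of_mem hq))

/-- A product of `s`-sparse homogeneous polynomials has a threshold degree `D` such that the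
factors of degree at most `D` make up half of the total degree, and so do the at most `d / D`
factors of degree at least `D`. -/
theorem exists_threshold (Q : Multiset (MvPolynomial σ F)) {d s : ℕ} (hd : 1 ≤ d) (hs : 1 ≤ s)
    (hom : ∀ q ∈ Q, q.IsHomogeneous q.totalDegree)
    (hsparse : ∀ q ∈ Q, q.support.card ≤ s) (hsum : (Q.map totalDegree).sum = d) :
    ∃ D, 1 ≤ D ∧ ∀ j δ : ℕ, 8 * δ ≤ 3 * d →
      (8 * (j * D) ≤ d → DerivsInSmallIdeal Q.prod j (d.choose j) δ) ∧
      (8 * j ≤ d → DerivsInSmallIdeal Q.prod j (s ^ (d / D) * d.choose j) δ) := by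
  classical
  -- The threshold is the least `D` with `low D ≥ d / 2`. By minimality the factors of degree below
  -- `D` carry less than half.
  set low : ℕ → ℕ := fun D => (Q.map fun q => if q.totalDegree ≤ D then q.totalDegree else 0).sum
    with hlow
  have hex : ∃ D, d ≤ 2 * low D := by
    refine ⟨d, ?_⟩
    have : low d = d := by
      rw [← hsum]
      simp only [hlow]
      refine congrArg _ (Multiset.map_congr rfl fun q hq => if_pos ?_)
      exact Multiset.le_sum_of_mem (Multiset.mem_map_of_mem _ hq)
    omega
  set D := Nat.find hex with hD
  have hDspec : d ≤ 2 * low D := Nat.find_spec hex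
  have hD1 : 1 ≤ D := by
    rw [Nat.one_le_iff_ne_zero]
    intro h0
    rw [h0] at hDspec
    have : low 0 = 0 := by
      simp only [hlow]
      refine Multiset.sum_eq_zero fun x hx => ?_
      obtain ⟨q, -, rfl⟩ := Multiset.mem_map.mp hx
      split_ifs <;> omega
    omega
  have hDmin : 2 * low (D - 1) < d := not_le.mp (Nat.find_min hex (by omega : D - 1 < D))
  refine ⟨D, hD1, fun j δ hδ => ⟨fun hj => ?_, fun hj => ?_⟩⟩
  -- Constant factors are left out so that `G` has at most `d` members. Dropping `j` of them loses
  -- degree at most `j * D ≤ d / 8` out of at least `d / 2`.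
  · set G := Q.filter fun q => 1 ≤ q.totalDegree ∧ q.totalDegree ≤ D with hG
    have hGsum : (G.map totalDegree).sum = low D := by
      rw [hG, multiset_sum_map_filter]
      refine congrArg _ (Multiset.map_congr rfl fun q _ => ?_)
      split_ifs <;> omega
    have hGQ : G ≤ Q := Multiset.filter_le _ _
    have hlowd : low D ≤ d := by
      obtain ⟨R, hR⟩ := Multiset.le_iff_exists_add.mp hGQ
      rw [← hGsum, ← hsum, hR, Multiset.map_add, Multiset.sum_add]
      exact Nat.le_add_right _ _
    have hGcard : Multiset.card G ≤ low D := by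
      rw [← hGsum]
      have := Multiset.card_nsmul_le_sum (s := G.map totalDegree) (a := 1) (by
        intro x hx
        obtain ⟨q, hq, rfl⟩ := Multiset.mem_map.mp hx
        exact (Multiset.mem_filter.mp hq).2.1)
      simpa using this
    have hbound : ∀ U ≤ G, (U.map totalDegree).sum ≤ Multiset.card U * D := by
      intro U hU
      have := Multiset.sum_le_card_nsmul (U.map totalDegree) D (by
        intro x hx
        obtain ⟨q, hq, rfl⟩ := Multiset.mem_map.mp hx
        exact (Multiset.mem_filter.mp (Multiset.mem_of_le hU hq)).2.2)
      simpa using this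
    have hjG : j ≤ Multiset.card G := by
      have h1 := hbound G le_rfl
      rw [hGsum] at h1
      refine Nat.le_of_mul_le_mul_right (c := D) ?_ hD1
      omega
    have hprod : Q.prod = G.prod * (Q.filter fun q => ¬ (1 ≤ q.totalDegree ∧ q.totalDegree ≤ D)).prod := by
      rw [hG, Multiset.prod_filter_mul_prod_filter_not]
    rw [hprod]
    refine derivsInSmallIdeal_prod_mul G _ hjG (hGcard.trans hlowd) fun U hU hc => ?_
    refine ⟨_, ?_, isHomogeneous_multiset_prod U fun q hq =>
      hom q (Multiset.mem_of_le (hU.trans hGQ) hq)⟩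
    have h1 := hbound (G - U) (Multiset.sub_le_self G U)
    have h2 : (U.map totalDegree).sum + ((G - U).map totalDegree).sum = low D := by
      rw [← hGsum, ← Multiset.sum_add, ← Multiset.map_add, add_tsub_cancel_of_le hU]
    have h3 : Multiset.card (G - U) = j := by
      rw [Multiset.card_sub hU, hc]
      omega
    rw [h3] at h1
    omega
  -- Every monomial of `H.prod` has degree at least `d / 2`, since `H.prod` is homogeneous; `j ≤ d /
  -- 8` derivatives leave at least `3d/8`.
  · set H := Q.filter fun q => D ≤ q.totalDegree with hH
    set L := Q.filter fun q => ¬ D ≤ q.totalDegree with hL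
    have hprod : Q.prod = H.prod * L.prod := (Multiset.prod_filter_mul_prod_filter_not _).symm
    have hLsum : (L.map totalDegree).sum = low (D - 1) := by
      rw [hL, multiset_sum_map_filter]
      refine congrArg _ (Multiset.map_congr rfl fun q _ => ?_)
      split_ifs <;> omega
    have hHL : (H.map totalDegree).sum + (L.map totalDegree).sum = d := by
      rw [← hsum, ← Multiset.sum_add, ← Multiset.map_add, hH, hL, Multiset.filter_add_not]
    have hHQ : H ≤ Q := Multiset.filter_le _ _
    have hHcard : Multiset.card H ≤ d / D := by
      rw [Nat.le_div_iff_mul_le hD1]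
      have := Multiset.card_nsmul_le_sum (s := H.map totalDegree) (a := D) (by
        intro x hx
        obtain ⟨q, hq, rfl⟩ := Multiset.mem_map.mp hx
        exact (Multiset.mem_filter.mp hq).2)
      rw [Multiset.card_map, smul_eq_mul] at this
      omega
    have hsupp : H.prod.support.card ≤ s ^ (d / D) :=
      (card_support_multiset_prod_le H fun q hq => hsparse q (Multiset.mem_of_le hHQ hq)).trans
        (Nat.pow_le_pow_right hs hHcard)
    have hexp : Q.prod =
        ∑ a ∈ H.prod.support, monomial a 1 * (C (coeff a H.prod) * L.prod) := by
      conv_lhs => rw [hprod, H.prod.as_sum, Finset.sum_mul]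
      refine Finset.sum_congr rfl fun a _ => ?_
      rw [← mul_assoc, mul_comm (monomial a 1), C_mul_monomial, mul_one]
    rw [hexp]
    refine (DerivsInSmallIdeal.sum _ _ fun a ha => ?_).mono (Nat.mul_le_mul_right _ hsupp)
    have hdeg : a.degree = (H.map totalDegree).sum := by
      by_contra hne
      exact (mem_support_iff.mp ha) ((isHomogeneous_multiset_prod H fun q hq =>
        hom q (Multiset.mem_of_le hHQ hq)).coeff_eq_zero hne)
    exact derivsInSmallIdeal_monomial_mul a _ (by omega) (by omega)

end Derivatives

/-! ### The monomials of the Nisan–Wigderson polynomial -/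

section Design

open MvPolynomial
open scoped Classical

variable (F : Type u) [Field F] (K : Type v) [Field K] [Fintype K]

/-- The polynomials of degree `< ⌊n / (2t)⌋`. -/
def designSet (t : ℕ) : Finset (Polynomial K) :=
  (finite_setOf_degree_lt K (Fintype.card K / (2 * t))).toFinset

variable {K} in
theorem mem_designSet {t : ℕ} {f : Polynomial K} :
    f ∈ designSet K t ↔ f.degree < ((Fintype.card K / (2 * t) : ℕ) : WithBot ℕ) := by
  simp [designSet]

theorem card_designSet (t : ℕ) :
    (designSet K t).card = Fintype.card K ^ (Fintype.card K / (2 * t)) := by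
  set k := Fintype.card K / (2 * t)
  have e : {f // f ∈ designSet K t} ≃ (Fin k → K) :=
    (Equiv.subtypeEquivRight fun f => by
      rw [mem_designSet, Polynomial.mem_degreeLT]).trans (Polynomial.degreeLTEquiv K k).toEquiv
  rw [← Fintype.card_coe, Fintype.card_congr e]
  simp

variable {K}

/-- The variables `y_t` and `x_{i,f(i)}`. -/
def nwVars (t : Fin (Fintype.card K)) (f : Polynomial K) : Finset (NWVar K) :=
  insert (Sum.inr t) (Finset.univ.image fun i => Sum.inl (i, f.eval i))

theorem inr_mem_nwVars {t t' : Fin (Fintype.card K)} {f : Polynomial K} :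
    Sum.inr t' ∈ nwVars t f ↔ t' = t := by
  simp [nwVars]

theorem inl_mem_nwVars {t : Fin (Fintype.card K)} {f : Polynomial K} {i j : K} :
    Sum.inl (i, j) ∈ nwVars t f ↔ f.eval i = j := by
  simp [nwVars]

theorem card_nwVars (t : Fin (Fintype.card K)) (f : Polynomial K) :
    (nwVars t f).card = Fintype.card K + 1 := by
  rw [nwVars, Finset.card_insert_of_notMem (by simp), Finset.card_image_of_injective,
    Finset.card_univ]
  intro i j h
  simpa using congrArg (fun s => Sum.elim Prod.fst (fun _ => 0) s) h

theorem eq_of_eval_eq_of_mem_designSet {t : ℕ} {f g : Polynomial K} (hf : f ∈ designSet K t)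
    (hg : g ∈ designSet K t) (A : Finset K) (hA : Fintype.card K / (2 * t) ≤ A.card)
    (h : ∀ i ∈ A, f.eval i = g.eval i) : f = g := by
  rw [mem_designSet] at hf hg
  have hA' : ((Fintype.card K / (2 * t) : ℕ) : WithBot ℕ) ≤ (A.card : WithBot ℕ) := by
    exact_mod_cast hA
  exact Polynomial.eq_of_degrees_lt_of_eval_finset_eq A (hf.trans_le hA') (hg.trans_le hA') h

theorem nwVars_injective {t t' : Fin (Fintype.card K)} {f g : Polynomial K}
    (hf : f ∈ designSet K (t + 1)) (hg : g ∈ designSet K (t' + 1))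
    (h : nwVars t f = nwVars t' g) : t = t' ∧ f = g := by
  have ht : t = t' := by
    rw [← inr_mem_nwVars (f := g), ← h, inr_mem_nwVars]
  subst ht
  refine ⟨rfl, eq_of_eval_eq_of_mem_designSet hf hg Finset.univ ?_ fun i _ => ?_⟩
  · rw [Finset.card_univ]
    exact Nat.div_le_self _ _
  · have h1 : Sum.inl (i, f.eval i) ∈ nwVars t f := inl_mem_nwVars.mpr rfl
    rw [h, inl_mem_nwVars] at h1
    exact h1.symm

theorem monomial_sqfreeExp {σ : Type v} (B : Finset σ) :
    monomial (sqfreeExp B) (1 : F) = ∏ v ∈ B, X v := by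
  induction B using Finset.induction_on with
  | empty => simp [sqfreeExp]
  | insert v B hv ih =>
    rw [Finset.prod_insert hv, ← ih, sqfreeExp, Finset.sum_insert hv, ← sqfreeExp, X,
      monomial_mul, one_mul]

theorem monomial_nwVars (t : Fin (Fintype.card K)) (f : Polynomial K) :
    monomial (sqfreeExp (nwVars t f)) (1 : F) =
      X (Sum.inr t) * ∏ i : K, X (Sum.inl (i, f.eval i)) := by
  rw [monomial_sqfreeExp, nwVars, Finset.prod_insert (by simp), Finset.prod_image]
  intro i _ j _ h
  simpa using congrArg (fun s => Sum.elim Prod.fst (fun _ => 0) s) h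

theorem nwDesign_eq_sum (t : ℕ) :
    NWDesign F K t = ∑ f ∈ designSet K t, ∏ i : K, X (Sum.inl (i, f.eval i)) := by
  exact finsum_mem_eq_finite_toFinset_sum _
    (finite_setOf_degree_lt K (Fintype.card K / (2 * t)))

theorem nwPoly_eq_sum :
    NWPoly F K = ∑ t : Fin (Fintype.card K), ∑ f ∈ designSet K (t + 1),
      monomial (sqfreeExp (nwVars t f)) 1 := by
  rw [NWPoly]
  refine Finset.sum_congr rfl fun t _ => ?_
  rw [nwDesign_eq_sum, Finset.mul_sum]
  exact Finset.sum_congr rfl fun f _ => (monomial_nwVars F t f).symm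

theorem sqfreeExp_injective {σ : Type v} : Function.Injective (sqfreeExp (σ := σ)) := by
  intro B B' h
  ext v
  have := DFunLike.congr_fun h v
  rw [sqfreeExp_apply, sqfreeExp_apply] at this
  by_cases h1 : v ∈ B <;> by_cases h2 : v ∈ B' <;> simp_all

theorem coeff_nwPoly {t : Fin (Fintype.card K)} {f : Polynomial K}
    (hf : f ∈ designSet K (t + 1)) : coeff (sqfreeExp (nwVars t f)) (NWPoly F K) = 1 := by
  rw [nwPoly_eq_sum, coeff_sum, Finset.sum_eq_single t, coeff_sum, Finset.sum_eq_single f]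
  · rw [coeff_monomial, if_pos rfl]
  · intro g hg hgf
    rw [coeff_monomial, if_neg]
    intro h
    exact hgf (nwVars_injective hg hf (sqfreeExp_injective h)).2
  · exact fun h => absurd hf h
  · intro t' _ ht'
    rw [coeff_sum]
    refine Finset.sum_eq_zero fun g hg => ?_
    rw [coeff_monomial, if_neg]
    intro h
    exact ht' (nwVars_injective hg hf (sqfreeExp_injective h)).1
  · exact fun h => absurd (Finset.mem_univ t) h

theorem zero_mem_designSet (t : ℕ) : (0 : Polynomial K) ∈ designSet K t := by
  rw [mem_designSet, Polynomial.degree_zero]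
  exact WithBot.bot_lt_coe _

theorem nwPoly_isHomogeneous : (NWPoly F K).IsHomogeneous (Fintype.card K + 1) := by
  rw [nwPoly_eq_sum]
  refine IsHomogeneous.sum _ _ _ fun t _ => IsHomogeneous.sum _ _ _ fun f _ => ?_
  refine isHomogeneous_monomial _ ?_
  rw [degree_sqfreeExp, card_nwVars]

theorem nwPoly_ne_zero : NWPoly F K ≠ 0 := by
  intro h
  have := coeff_nwPoly F (zero_mem_designSet (K := K) ((⟨0, Fintype.card_pos⟩ :
    Fin (Fintype.card K)) + 1))
  rw [h] at this
  simp at this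

theorem totalDegree_nwPoly : (NWPoly F K).totalDegree = Fintype.card K + 1 :=
  (nwPoly_isHomogeneous F).totalDegree (nwPoly_ne_zero F)

theorem nwVars_subset_vars {t : Fin (Fintype.card K)} {f : Polynomial K}
    (hf : f ∈ designSet K (t + 1)) : nwVars t f ⊆ (NWPoly F K).vars := by
  intro v hv
  rw [mem_vars_iff_mem_support]
  refine ⟨sqfreeExp (nwVars t f), ?_, ?_⟩
  · rw [mem_support_iff, coeff_nwPoly F hf]
    exact one_ne_zero
  · rw [Finsupp.mem_support_iff, sqfreeExp_apply, if_pos hv]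
    exact one_ne_zero

/-- The constant `f = j` is admitted for `t = 1` because `n ≥ 2`, which yields `x_{i,j}`. The zero
polynomial is admitted for every `t`, even when `⌊n/(2t)⌋ = 0`, which yields `y_t`. -/
theorem vars_nwPoly : (NWPoly F K).vars = Finset.univ := by
  rw [Finset.eq_univ_iff_forall]
  rintro (⟨i, j⟩ | t)
  · have hc : Polynomial.C j ∈ designSet K ((⟨0, Fintype.card_pos⟩ : Fin (Fintype.card K)) + 1) := by
      rw [mem_designSet]
      refine Polynomial.degree_C_le.trans_lt ?_
      have : 0 < Fintype.card K / (2 * (0 + 1)) :=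
        Nat.div_pos (by simpa using Nat.succ_le_of_lt (Fintype.one_lt_card (α := K))) (by norm_num)
      exact_mod_cast this
    exact nwVars_subset_vars F hc (inl_mem_nwVars.mpr (by simp))
  · exact nwVars_subset_vars F (zero_mem_designSet (t + 1)) (inr_mem_nwVars.mpr rfl)

/-! ### Derivatives of the Nisan–Wigderson polynomial -/

theorem pderiv_monomial_sqfreeExp {σ : Type v} [DecidableEq σ] (v : σ) (B : Finset σ) :
    pderiv v (monomial (sqfreeExp B) (1 : F)) =
      if v ∈ B then monomial (sqfreeExp (B.erase v)) 1 else 0 := by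
  rw [pderiv_monomial, sqfreeExp_apply]
  split_ifs with h
  · rw [Nat.cast_one, one_mul]
    congr 2
    ext w
    rw [Finsupp.tsub_apply, sqfreeExp_apply, sqfreeExp_apply, Finsupp.single_apply]
    by_cases hw : v = w
    · subst hw; simp [h]
    · simp [hw, Ne.symm hw]
  · simp

theorem iterDeriv_monomial_sqfreeExp {σ : Type v} [DecidableEq σ] (V : List σ) (hV : V.Nodup) (B : Finset σ) :
    iterDeriv V (monomial (sqfreeExp B) (1 : F)) =
      if V.toFinset ⊆ B then monomial (sqfreeExp (B \ V.toFinset)) 1 else 0 := by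
  induction V with
  | nil => simp [iterDeriv]
  | cons v V ih =>
    rw [List.nodup_cons] at hV
    rw [iterDeriv, LinearMap.comp_apply, ih hV.2]
    split_ifs with h1 h2 h2
    · have hv : v ∈ B := h2 (by simp)
      erw [pderiv_monomial_sqfreeExp]
      rw [if_pos (by simp [hv, hV.1])]
      congr 2
      rw [List.toFinset_cons, Finset.sdiff_insert]
    · erw [pderiv_monomial_sqfreeExp]
      rw [if_neg]
      intro hv
      refine h2 fun w hw => ?_
      rw [List.toFinset_cons, Finset.mem_insert] at hw
      rcases hw with rfl | hw
      · exact (Finset.mem_sdiff.mp hv).1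
      · exact h1 hw
    · exact absurd (fun w hw => h2 (by rw [List.toFinset_cons]; exact Finset.mem_insert_of_mem hw)) h1
    · exact map_zero _

/-- The variables `y_t` and `x_{i,f(i)}` for `i ∈ A`. -/
def nwVarsOn (t : Fin (Fintype.card K)) (A : Finset K) (f : Polynomial K) : Finset (NWVar K) :=
  insert (Sum.inr t) (A.image fun i => Sum.inl (i, f.eval i))

theorem card_nwVarsOn (t : Fin (Fintype.card K)) (A : Finset K) (f : Polynomial K) :
    (nwVarsOn t A f).card = A.card + 1 := by
  rw [nwVarsOn, Finset.card_insert_of_notMem (by simp), Finset.card_image_of_injective]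
  intro i j h
  simpa using congrArg (fun s => Sum.elim Prod.fst (fun _ => 0) s) h

theorem nwVarsOn_subset (t : Fin (Fintype.card K)) (A : Finset K) (f : Polynomial K) :
    nwVarsOn t A f ⊆ nwVars t f :=
  Finset.insert_subset_insert _ (Finset.image_subset_image (Finset.subset_univ A))

/-- The variable `y_t` fixes the summand, and the values on `A` fix the polynomial by interpolation.
-/
theorem nwVarsOn_subset_nwVars_iff {t t' : Fin (Fintype.card K)} {A : Finset K}
    {f g : Polynomial K} (hA : Fintype.card K / (2 * (t + 1)) ≤ A.card)
    (hf : f ∈ designSet K (t + 1)) (hg : g ∈ designSet K (t' + 1)) :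
    nwVarsOn t A f ⊆ nwVars t' g ↔ t' = t ∧ g = f := by
  constructor
  · intro h
    have ht : t = t' := by
      rw [← inr_mem_nwVars (f := g)]
      exact h (Finset.mem_insert_self _ _)
    subst ht
    refine ⟨rfl, eq_of_eval_eq_of_mem_designSet hg hf A hA fun i hi => ?_⟩
    rw [← inl_mem_nwVars (t := t)]
    exact h (Finset.mem_insert_of_mem (Finset.mem_image_of_mem _ hi))
  · rintro ⟨rfl, rfl⟩
    exact nwVarsOn_subset _ _ _

theorem iterDeriv_nwPoly {t : Fin (Fintype.card K)} {A : Finset K}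
    {f : Polynomial K} (hA : Fintype.card K / (2 * (t + 1)) ≤ A.card)
    (hf : f ∈ designSet K (t + 1)) :
    iterDeriv (nwVarsOn t A f).toList (NWPoly F K) =
      monomial (sqfreeExp (nwVars t f \ nwVarsOn t A f)) 1 := by
  have key : ∀ t' : Fin (Fintype.card K), ∀ g ∈ designSet K (t' + 1),
      iterDeriv (nwVarsOn t A f).toList (monomial (sqfreeExp (nwVars t' g)) (1 : F)) =
        if t' = t ∧ g = f then monomial (sqfreeExp (nwVars t f \ nwVarsOn t A f)) 1 else 0 := by
    intro t' g hg
    rw [iterDeriv_monomial_sqfreeExp F _ (Finset.nodup_toList _), Finset.toList_toFinset]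
    have hiff := nwVarsOn_subset_nwVars_iff hA hf hg
    by_cases h : t' = t ∧ g = f
    · rw [if_pos h, if_pos (hiff.mpr h), h.1, h.2]
    · rw [if_neg h, if_neg fun h' => h (hiff.mp h')]
  rw [nwPoly_eq_sum, map_sum, Finset.sum_eq_single t, map_sum, Finset.sum_eq_single f]
  · rw [key t f hf, if_pos ⟨rfl, rfl⟩]
  · intro g hg hgf
    rw [key t g hg, if_neg fun h => hgf h.2]
  · exact fun h => absurd hf h
  · intro t' _ ht'
    rw [map_sum]
    exact Finset.sum_eq_zero fun g hg => by rw [key t' g hg, if_neg fun h => ht' h.1]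
  · exact fun h => absurd (Finset.mem_univ t) h

theorem nwVars_sdiff_nwVarsOn (t : Fin (Fintype.card K)) (A : Finset K) (f : Polynomial K) :
    nwVars t f \ nwVarsOn t A f = Aᶜ.image fun i => Sum.inl (i, f.eval i) := by
  ext v
  rcases v with ⟨i, j⟩ | t'
  · simp only [nwVars, nwVarsOn, Finset.mem_sdiff, Finset.mem_insert, Finset.mem_image,
      Finset.mem_univ, true_and, Finset.mem_compl, reduceCtorEq, false_or, Sum.inl.injEq,
      Prod.mk.injEq]
    constructor
    · rintro ⟨⟨i', rfl, rfl⟩, h⟩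
      exact ⟨i', fun hi => h ⟨i', hi, rfl, rfl⟩, rfl, rfl⟩
    · rintro ⟨i', hi, rfl, rfl⟩
      refine ⟨⟨i', rfl, rfl⟩, ?_⟩
      rintro ⟨i'', hi'', rfl, -⟩
      exact hi hi''
  · simp [nwVars, nwVarsOn]

theorem card_remaining (t : Fin (Fintype.card K)) (A : Finset K) (f : Polynomial K) :
    (nwVars t f \ nwVarsOn t A f).card = Fintype.card K - A.card := by
  rw [Finset.card_sdiff_of_subset (nwVarsOn_subset t A f), card_nwVars, card_nwVarsOn]
  omega

/-- Two of the remaining monomials share few variables. -/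
theorem card_union_remaining {t : Fin (Fintype.card K)} {A : Finset K} {f g : Polynomial K}
    (hA : A.card = Fintype.card K / (2 * (t + 1)))
    (hf : f ∈ designSet K (t + 1)) (hg : g ∈ designSet K (t + 1)) (hfg : f ≠ g) :
    (Fintype.card K - A.card) + (Fintype.card K - 2 * A.card) ≤
      ((nwVars t f \ nwVarsOn t A f) ∪ (nwVars t g \ nwVarsOn t A g)).card := by
  have h1 := Finset.card_union_add_card_inter (nwVars t f \ nwVarsOn t A f)
    (nwVars t g \ nwVarsOn t A g)
  rw [card_remaining, card_remaining] at h1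
  set I := (nwVars t f \ nwVarsOn t A f) ∩ (nwVars t g \ nwVarsOn t A g) with hI
  set Z := Finset.univ.filter fun i : K => f.eval i = g.eval i with hZ
  -- Distinct design polynomials agree on fewer points than their degree bound.
  have hZc : Z.card < A.card := by
    by_contra hle
    refine hfg (eq_of_eval_eq_of_mem_designSet hf hg Z (by omega) fun i hi => ?_)
    exact (Finset.mem_filter.mp hi).2
  have hIZ : I ⊆ Z.image fun i => Sum.inl (i, f.eval i) := by
    intro v hv
    rw [hI, nwVars_sdiff_nwVarsOn, nwVars_sdiff_nwVarsOn, Finset.mem_inter] at hv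
    obtain ⟨i, -, rfl⟩ := Finset.mem_image.mp hv.1
    obtain ⟨i', -, h⟩ := Finset.mem_image.mp hv.2
    rw [Sum.inl.injEq, Prod.mk.injEq] at h
    obtain ⟨rfl, h⟩ := h
    exact Finset.mem_image_of_mem _ (Finset.mem_filter.mpr ⟨Finset.mem_univ _, h.symm⟩)
  have hIc : I.card ≤ Z.card := (Finset.card_le_card hIZ).trans Finset.card_image_le
  have hn : 2 * A.card ≤ Fintype.card K := by
    have h2 := Nat.div_mul_le_self (Fintype.card K) (2 * (t + 1))
    rw [← hA] at h2
    nlinarith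
  omega

end Design

/-! ### The lower bound for an ideal containing the derivatives -/

/-- A discrete crossing argument: the left side is at least `2 * n ^ k` at `l = 1` and tends to `1`,
so some `l` satisfies the bound while `l + 1` does not. -/
theorem exists_shift_degree {N n k : ℕ} (hn : 2 ≤ n) (hN : n ^ 2 ≤ N) (hk : 1 ≤ k)
    (hkn : 12 * k ≤ n) :
    ∃ l : ℕ, 1 ≤ l ∧ (2 * (n : ℝ) ^ k) ≤ (1 + ((N : ℝ) - 1) / l) ^ (n - 2 * k) ∧
      (1 + ((N : ℝ) - 1) / (l + 1)) ^ (n - 2 * k) < 2 * (n : ℝ) ^ k := by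
  have hn1 : (1 : ℝ) ≤ n := by exact_mod_cast (by omega : 1 ≤ n)
  by_contra hcon
  push Not at hcon
  have hall : ∀ l : ℕ, 1 ≤ l → (2 * (n : ℝ) ^ k) ≤ (1 + ((N : ℝ) - 1) / l) ^ (n - 2 * k) := by
    intro l hl
    induction l, hl using Nat.le_induction with
    | base =>
      have hN' : (n : ℝ) ^ 2 ≤ N := by exact_mod_cast hN
      have e : (1 + ((N : ℝ) - 1) / (1 : ℕ)) = N := by simp
      rw [e]
      calc 2 * (n : ℝ) ^ k ≤ n * (n : ℝ) ^ k := by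
            gcongr
            exact_mod_cast hn
        _ = (n : ℝ) ^ (k + 1) := by ring
        _ ≤ (n : ℝ) ^ (2 * (n - 2 * k)) := pow_le_pow_right₀ hn1 (by omega)
        _ = ((n : ℝ) ^ 2) ^ (n - 2 * k) := by rw [pow_mul]
        _ ≤ _ := by gcongr
    | succ l hl ih =>
      have := hcon l hl ih
      exact_mod_cast this
  have hlim : Tendsto (fun l : ℕ => (1 + ((N : ℝ) - 1) / l) ^ (n - 2 * k)) atTop (𝓝 1) := by
    have h0 : Tendsto (fun l : ℕ => ((N : ℝ) - 1) / l) atTop (𝓝 0) :=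
      tendsto_const_div_atTop_nhds_zero_nat _
    have := (h0.const_add 1).pow (n - 2 * k)
    simpa using this
  have hev := (hlim.eventually_lt_const (by norm_num : (1 : ℝ) < 2)).and (eventually_ge_atTop 1)
  obtain ⟨l, hl, hl1⟩ := hev.exists
  have h1 := hall l hl1
  have h2 : (1 : ℝ) ≤ (n : ℝ) ^ k := one_le_pow₀ hn1
  linarith

-- The order is `k + 1` because one derivative is spent on `y_t` and `k` on the `x`-variables. The
-- remaining monomials and all their multiples lie in the ideal, and the two counts in degree `n - k
-- + l` are compared.
open MvPolynomial in
theorem pow_le_of_derivsInSmallIdeal (F : Type u) [Field F] {K : Type v} [Field K] [Fintype K]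
    (t : Fin (Fintype.card K)) {n k b : ℕ} (hnK : Fintype.card K = n)
    (hkt : Fintype.card K / (2 * (t + 1)) = k) (hk : 1 ≤ k) (hkn : 12 * k ≤ n)
    (h : DerivsInSmallIdeal (NWPoly F K) (k + 1) b (3 * n / 8)) :
    (n : ℝ) ^ k ≤ 128 * (b : ℝ) ^ 4 := by
  classical
  obtain ⟨𝒰, hcard, hhom, hder⟩ := h
  set N := Fintype.card (NWVar K)
  have hN : N = n ^ 2 + n := by simp [N, sq, hnK]
  obtain ⟨l, hl, hl1, hl2⟩ := exists_shift_degree (N := N) (by omega : 2 ≤ n) (by omega) hk hkn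
  obtain ⟨A, -, hA⟩ := Finset.exists_subset_card_eq
    (by rw [Finset.card_univ]; omega : k ≤ (Finset.univ : Finset K).card)
  have hA' : A.card = Fintype.card K / (2 * (t + 1)) := hA.trans hkt.symm
  set s := designSet K (t + 1)
  have hs : s.card = n ^ k := by rw [card_designSet, hkt, hnK]
  set B : Polynomial K → Finset (NWVar K) := fun f => nwVars t f \ nwVarsOn t A f
  have hlow := card_multiples_ge s B (b := n - k) (g := n - 2 * k) (l := l)
    (fun f _ => by rw [card_remaining, hA, hnK])
    (fun f hf g hg hfg => by
      have := card_union_remaining hA' hf hg hfg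
      refine le_trans (le_of_eq ?_) this
      rw [hA, hnK]) hl (by omega) (by rw [hs]; push_cast; exact hl1)
  set S := (exponents (NWVar K) (n - k + l)).filter (fun γ => ∃ f ∈ s, sqfreeExp (B f) ≤ γ)
  have hup : S.card ≤ 𝒰.card * Nat.multichoose N (n - k + l - 3 * n / 8) := by
    refine card_monomials_le_of_mem_span (F := F) (by omega) 𝒰 hhom S fun γ hγ => ?_
    rw [Finset.mem_filter, mem_exponents] at hγ
    obtain ⟨hdeg, f, hf, hle⟩ := hγ
    refine ⟨hdeg, ?_⟩
    have hmem := hder (nwVarsOn t A f).toList (by rw [Finset.length_toList, card_nwVarsOn, hA])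
    rw [iterDeriv_nwPoly F hA'.ge hf] at hmem
    have := Ideal.mul_mem_left _ (monomial (γ - sqfreeExp (B f)) (1 : F)) hmem
    rwa [monomial_mul, one_mul, tsub_add_cancel_of_le hle] at this
  set ρ := 1 + ((N : ℝ) - 1) / (l + 1) with hρ
  have hρ1 : 1 ≤ ρ := by
    have : (1 : ℝ) ≤ N := by exact_mod_cast (by omega : 1 ≤ N)
    have : 0 ≤ ((N : ℝ) - 1) / (l + 1) := div_nonneg (by linarith) (by positivity)
    linarith
  set j := n - k - 3 * n / 8
  have hj : n - k + l - 3 * n / 8 = l + j := by omega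
  have hM := multichoose_add_le (N := N) (l := l) (by omega) j
  have hMpos : (0 : ℝ) < Nat.multichoose N l := by
    rw [← card_exponents]
    have : (exponents (NWVar K) l).Nonempty :=
      ⟨Finsupp.single (Sum.inr t) l, by rw [mem_exponents, Finsupp.degree_single]⟩
    exact_mod_cast this.card_pos
  rw [hj] at hup
  have hup' : (S.card : ℝ) ≤ b * (Nat.multichoose N l * ρ ^ j) := by
    calc (S.card : ℝ) ≤ (𝒰.card * Nat.multichoose N (l + j) : ℕ) := by exact_mod_cast hup
      _ = (𝒰.card : ℝ) * Nat.multichoose N (l + j) := by push_cast; rfl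
      _ ≤ _ := by gcongr
  have hmain : (n : ℝ) ^ k / 2 ≤ b * ρ ^ j := by
    have := hlow.trans hup'
    rw [hs] at this
    push_cast at this
    refine le_of_mul_le_mul_right ?_ hMpos
    calc _ = (n : ℝ) ^ k * Nat.multichoose N l / 2 := by ring
      _ ≤ _ := this
      _ = _ := by ring
  -- Here `j` is about `5n/8 - k`, and `4 * j ≤ 3 * (n - 2 * k)` thanks to `12 * k ≤ n`. Exceeding
  -- degree `n / 4` in the generators is what brings this exponent below `1`.
  have hρj : (ρ ^ j) ^ 4 ≤ (2 * (n : ℝ) ^ k) ^ 3 := by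
    calc (ρ ^ j) ^ 4 = ρ ^ (j * 4) := by rw [pow_mul]
      _ ≤ ρ ^ ((n - 2 * k) * 3) := pow_le_pow_right₀ hρ1 (by omega)
      _ = (ρ ^ (n - 2 * k)) ^ 3 := by rw [pow_mul]
      _ ≤ _ := by gcongr
  have hpos : (0 : ℝ) < (n : ℝ) ^ k := by
    have : (0 : ℝ) < n := by exact_mod_cast (by omega : 0 < n)
    positivity
  have h4 : ((n : ℝ) ^ k / 2) ^ 4 ≤ (b : ℝ) ^ 4 * (2 * (n : ℝ) ^ k) ^ 3 := by
    calc ((n : ℝ) ^ k / 2) ^ 4 ≤ (b * ρ ^ j) ^ 4 := by gcongr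
      _ = (b : ℝ) ^ 4 * (ρ ^ j) ^ 4 := by ring
      _ ≤ _ := by gcongr
  generalize (n : ℝ) ^ k = x at h4 hpos ⊢
  have h5 : x ^ 3 * x ≤ x ^ 3 * (128 * (b : ℝ) ^ 4) := by nlinarith [h4]
  exact le_of_mul_le_mul_left h5 (by positivity)

/-! ### Depth-four circuits -/

namespace SPSPCircuit

open MvPolynomial

variable {F : Type u} [Field F] {σ : Type v} (C : SPSPCircuit F σ)

theorem exists_botProdVal_eq (i : Fin C.numBotProds) : ∃ a c, C.botProdVal i = monomial a c := by
  unfold botProdVal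
  induction C.botProd i using Multiset.induction_on with
  | empty => exact ⟨0, 1, by simp⟩
  | cons x U ih =>
    obtain ⟨a, c, h⟩ := ih
    rw [Multiset.map_cons, Multiset.prod_cons, h]
    unfold leafVal
    rcases C.leaf x with v | y
    · exact ⟨Finsupp.single v 1 + a, 1 * c, by rw [Sum.elim_inl, X, monomial_mul]⟩
    · exact ⟨a, y * c, by rw [Sum.elim_inr, C_mul_monomial]⟩

/-- A bottom product is a scalar times one monomial, so shared or parallel edges create no new
exponents. -/
theorem card_support_sumGateVal_le (i : Fin C.numSums) :
    (C.sumGateVal i).support.card ≤ C.size := by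
  classical
  choose a c hac using C.exists_botProdVal_eq
  have hsub : (C.sumGateVal i).support ⊆ Finset.univ.image a := by
    unfold sumGateVal
    induction C.sumGate i using Multiset.induction_on with
    | empty => simp
    | cons x U ih =>
      rw [Multiset.map_cons, Multiset.sum_cons]
      refine support_add.trans (Finset.union_subset ?_ ih)
      rw [hac]
      refine support_monomial_subset.trans ?_
      simp
  refine (Finset.card_le_card hsub).trans (Finset.card_image_le.trans ?_)
  rw [Finset.card_univ, Fintype.card_fin, size]
  omega

/-- Each variable needs its own leaf. This bound covers the range where the claimed size is at most
`n ^ 2`. -/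
theorem card_le_size_of_vars_val [Fintype σ] (h : C.val.vars = Finset.univ) :
    Fintype.card σ ≤ C.size := by
  set L : Set σ := {v | ∃ i, C.leaf i = Sum.inl v} with hL
  have hleaf : ∀ i, C.leafVal i ∈ supported F L := by
    intro i
    unfold leafVal
    rcases hi : C.leaf i with v | y
    · exact X_mem_supported.mpr ⟨i, hi⟩
    · exact (supported F L).algebraMap_mem y
  have hval : C.val ∈ supported F L := by
    unfold val topProdVal sumGateVal botProdVal
    refine multiset_sum_mem _ fun x hx => ?_
    obtain ⟨i, -, rfl⟩ := Multiset.mem_map.mp hx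
    refine multiset_prod_mem _ fun x hx => ?_
    obtain ⟨i, -, rfl⟩ := Multiset.mem_map.mp hx
    refine multiset_sum_mem _ fun x hx => ?_
    obtain ⟨i, -, rfl⟩ := Multiset.mem_map.mp hx
    refine multiset_prod_mem _ fun x hx => ?_
    obtain ⟨i, -, rfl⟩ := Multiset.mem_map.mp hx
    exact hleaf i
  rw [mem_supported, h] at hval
  have hall : ∀ v, ∃ i, C.leaf i = Sum.inl v := fun v => hval (by simp)
  choose φ hφ using hall
  have hinj : Function.Injective φ := by
    intro v w hvw
    have := hφ v
    rw [hvw, hφ w] at this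
    exact (Sum.inl_injective this).symm
  have := Fintype.card_le_of_injective φ hinj
  rw [Fintype.card_fin] at this
  rw [size]
  omega

/-- Each product gate of a homogeneous circuit has a threshold degree that controls its iterated
derivatives. -/
theorem exists_thresholds (hC : C.IsHomogeneous) {d : ℕ} (hd : 1 ≤ d)
    (hval : C.val.IsHomogeneous d) :
    ∃ Ds : Finset ℕ, Ds.card ≤ C.topFanIn ∧ ∀ j δ b : ℕ, 1 ≤ b → 8 * δ ≤ 3 * d → 8 * j ≤ d →
      (∀ D ∈ Ds, 8 * (j * D) ≤ d ∨ C.size ^ (d / D) ≤ b) →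
      DerivsInSmallIdeal C.val j (C.topFanIn * (b * d.choose j)) δ := by
  classical
  obtain ⟨-, -, hsum, htop, -⟩ := hC
  -- Products of other degrees may occur and cancel. Taking the component of degree `d` removes
  -- them; repeated output edges do not matter for ideal membership.
  set O := C.output.toFinset.filter fun i => C.topProdVal i ≠ 0 ∧ (C.topProdVal i).IsHomogeneous d
  have hOcard : O.card ≤ C.topFanIn :=
    (Finset.card_filter_le _ _).trans (Multiset.toFinset_card_le _)
  have hth : ∀ i ∈ O, ∃ D, 1 ≤ D ∧ ∀ j δ : ℕ, 8 * δ ≤ 3 * d →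
      (8 * (j * D) ≤ d → DerivsInSmallIdeal (C.topProdVal i) j (d.choose j) δ) ∧
      (8 * j ≤ d → DerivsInSmallIdeal (C.topProdVal i) j (C.size ^ (d / D) * d.choose j) δ) := by
    intro i hi
    obtain ⟨-, hne, hhom⟩ := Finset.mem_filter.mp hi
    have hq0 : ∀ q ∈ (C.topProd i).map C.sumGateVal, q ≠ 0 := by
      intro q hq h0
      exact hne (Multiset.prod_eq_zero (h0 ▸ hq))
    have hqhom : ∀ q ∈ (C.topProd i).map C.sumGateVal, q.IsHomogeneous q.totalDegree := by
      intro q hq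
      have h0 := hq0 q hq
      obtain ⟨x, -, rfl⟩ := Multiset.mem_map.mp hq
      obtain ⟨e, he⟩ := hsum x
      rwa [he.totalDegree h0]
    refine exists_threshold _ hd (by rw [size]; omega) hqhom ?_ ?_
    · intro q hq
      obtain ⟨x, -, rfl⟩ := Multiset.mem_map.mp hq
      exact C.card_support_sumGateVal_le x
    · exact (isHomogeneous_multiset_prod _ hqhom).inj_right hhom hne
  choose! D hD1 hD2 using hth
  refine ⟨O.image D, Finset.card_image_le.trans hOcard, fun j δ b hb hδ hj hor => ?_⟩
  have hder : ∀ i ∈ O, DerivsInSmallIdeal (C.topProdVal i) j (b * d.choose j) δ := by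
    intro i hi
    obtain ⟨h1, h2⟩ := hD2 i hi j δ hδ
    rcases hor (D i) (Finset.mem_image_of_mem _ hi) with h | h
    · exact (h1 h).mono (Nat.le_mul_of_pos_left _ hb)
    · exact (h2 hj).mono (Nat.mul_le_mul_right _ h)
  choose! 𝒰 hU1 hU2 hU3 using hder
  refine ⟨O.biUnion 𝒰, ?_, ?_, ?_⟩
  · exact (Finset.card_biUnion_le_card_mul _ _ _ hU1).trans (Nat.mul_le_mul_right _ hOcard)
  · intro p hp
    obtain ⟨i, hi, hp⟩ := Finset.mem_biUnion.mp hp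
    exact hU2 i hi p hp
  · intro V hV
    have hcomp : ∀ i ∈ C.output, homogeneousComponent d (C.topProdVal i) =
        if i ∈ O then C.topProdVal i else 0 := by
      intro i hi
      split_ifs with h
      · exact homogeneousComponent_eq_self (Finset.mem_filter.mp h).2.2
      · by_cases h0 : C.topProdVal i = 0
        · rw [h0, map_zero]
        · obtain ⟨e, he⟩ := htop i
          rw [homogeneousComponent_of_mem he, if_neg]
          rintro rfl
          exact h (Finset.mem_filter.mpr ⟨Multiset.mem_toFinset.mpr hi, h0, he⟩)
    have hsplit : C.val = (C.output.map fun i => if i ∈ O then C.topProdVal i else 0).sum := by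
      rw [← homogeneousComponent_eq_self hval, val, map_multiset_sum, Multiset.map_map]
      exact congrArg _ (Multiset.map_congr rfl hcomp)
    rw [hsplit, map_multiset_sum, Multiset.map_map]
    refine multiset_sum_mem _ fun x hx => ?_
    obtain ⟨i, -, rfl⟩ := Multiset.mem_map.mp hx
    rw [Function.comp_apply]
    split_ifs with h
    · refine Ideal.span_mono ?_ (hU3 i h V hV)
      exact_mod_cast Finset.subset_biUnion_of_mem 𝒰 h
    · rw [map_zero]
      exact Ideal.zero_mem _

end SPSPCircuit

/-! ### Choice of parameters -/

/-- Among `r + 1` disjoint scales one is avoided by at most `r` numbers. -/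
theorem exists_avoided_scale (Ds : Finset ℕ) {r : ℕ} (hr : Ds.card ≤ r) {μ : ℝ} (hμ : 1 < μ) :
    ∃ j ≤ r, ∀ D ∈ Ds, (D : ℝ) ≤ μ ^ j ∨ μ ^ (j + 1) < D := by
  by_contra! hcon
  have h : ∀ j ∈ Finset.range (r + 1), ∃ D ∈ Ds, μ ^ j < (D : ℝ) ∧ (D : ℝ) ≤ μ ^ (j + 1) :=
    fun j hj => hcon j (Nat.lt_succ_iff.mp (Finset.mem_range.mp hj))
  choose! φ hφ h1 h2 using h
  have hinj : Set.InjOn φ (Finset.range (r + 1)) := by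
    have hlt : ∀ i ∈ Finset.range (r + 1), ∀ j ∈ Finset.range (r + 1), i < j → φ i < φ j := by
      intro i hi j hj hij
      have : (φ i : ℝ) < φ j :=
        (h2 i hi).trans_lt ((pow_le_pow_right₀ hμ.le hij).trans_lt (h1 j hj))
      exact_mod_cast this
    intro i hi j hj hij
    rcases lt_trichotomy i j with h | h | h
    · exact absurd hij (hlt i hi j hj h).ne
    · exact h
    · exact absurd hij (hlt j hj i hi h).ne'
  have := Finset.card_le_card_of_injOn φ hφ hinj
  rw [Finset.card_range] at this
  omega

/-- This is the estimate `(e * n / k) ^ k` with `e < 3`. -/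
theorem choose_le_exp_pow (n k : ℕ) {x : ℝ} (h : (n : ℝ) ≤ x * k) :
    (n.choose k : ℝ) ≤ (3 * x) ^ k := by
  rcases Nat.eq_zero_or_pos k with rfl | hk
  · simp
  have hk' : (0 : ℝ) < k := by exact_mod_cast hk
  have hx : 0 ≤ x := by
    by_contra hx
    have : x * k < 0 := mul_neg_of_neg_of_pos (not_le.mp hx) hk'
    have : (0 : ℝ) ≤ n := Nat.cast_nonneg n
    linarith
  have h1 : (n.choose k : ℝ) ≤ (n : ℝ) ^ k / k.factorial := Nat.choose_le_pow_div k n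
  have h2 : (k : ℝ) ^ k / k.factorial ≤ Real.exp k :=
    Real.pow_div_factorial_le_exp k hk'.le k
  have h3 : Real.exp k ≤ 3 ^ k := by
    rw [← Real.exp_one_pow]
    exact pow_le_pow_left₀ (Real.exp_pos 1).le (Real.exp_one_lt_three.le) k
  have hf : (0 : ℝ) < k.factorial := by exact_mod_cast k.factorial_pos
  calc (n.choose k : ℝ) ≤ (n : ℝ) ^ k / k.factorial := h1
    _ ≤ (x * k) ^ k / k.factorial := by gcongr
    _ = x ^ k * ((k : ℝ) ^ k / k.factorial) := by rw [mul_pow]; ring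
    _ ≤ x ^ k * 3 ^ k := by gcongr; exact h2.trans h3
    _ = _ := by rw [mul_pow]; ring

theorem natCast_eq_rpow_pow {n : ℕ} (N : ℕ) (hN : N ≠ 0) :
    (((n : ℝ) ^ ((N : ℝ)⁻¹)) ^ N : ℝ) = n :=
  Real.rpow_inv_natCast_pow (Nat.cast_nonneg n) hN

/-- The main lower bound, with `w = n^{1/10000} = ν^r`. -/
theorem rpow_le_size_of_two_lt (F : Type u) [Field F] {K : Type v} [Field K] [Fintype K] {n r : ℕ}
    (hnK : Fintype.card K = n) {w ν : ℝ} (hw : w ^ 10000 = n) (hν : 2 < ν) (hνr : ν ^ r = w)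
    (hr : 1 ≤ r) (C : SPSPCircuit F (NWVar K)) (hC : C.IsHomogeneous) (hfan : C.topFanIn ≤ r)
    (hval : C.val = NWPoly F K) : (n : ℝ) ^ ν ≤ C.size := by
  by_contra! hlt
  have hν1 : 1 < ν := by linarith
  have hνw : ν ≤ w := by
    rw [← hνr]
    exact le_self_pow₀ hν1.le (by omega)
  have hw2 : 2 < w := hν.trans_le hνw
  have hw1 : 1 ≤ w := by linarith
  have hw0 : 0 < w := by linarith
  have hn0 : (0 : ℝ) < n := by rw [← hw]; positivity
  have hrw : (r : ℝ) ≤ w := by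
    have h1 : (r : ℝ) ≤ 2 ^ r := by exact_mod_cast Nat.lt_two_pow_self.le
    calc (r : ℝ) ≤ 2 ^ r := h1
      _ ≤ ν ^ r := by gcongr
      _ = w := hνr
  have hhom : C.val.IsHomogeneous (n + 1) := by
    rw [hval, ← hnK]
    exact nwPoly_isHomogeneous F
  obtain ⟨Ds, hDs, hder⟩ := C.exists_thresholds hC (by omega : 1 ≤ n + 1) hhom
  -- The gap ratio is `ν ^ 12`: one factor `ν` pays for the exponent of the assumed size `n ^ ν`,
  -- and the other eleven, each above `2`, absorb constants.
  obtain ⟨i, hir, havoid⟩ := exists_avoided_scale Ds (hDs.trans hfan)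
    (one_lt_pow₀ hν1 (by norm_num : (12 : ℕ) ≠ 0))
  set D : ℝ := (ν ^ 12) ^ i with hD
  have hD1 : 1 ≤ D := one_le_pow₀ (one_le_pow₀ hν1.le)
  have hDw : D ≤ w ^ 12 := by
    calc D = ν ^ (12 * i) := by rw [hD, ← pow_mul]
      _ ≤ ν ^ (r * 12) := pow_le_pow_right₀ hν1.le (by omega)
      _ = w ^ 12 := by rw [pow_mul, hνr]
  -- This makes `k = ⌊n/(2T)⌋` about `n / (16 * D)`, so that `8 * (k + 1) * x ≤ n` still holds for
  -- thresholds `x ≤ D`, using `k + 1 ≤ 2 * k`.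
  set T := ⌈8 * D⌉₊ with hT
  have hT1 : 8 * D ≤ T := Nat.le_ceil _
  have hT2 : (T : ℝ) ≤ 9 * D := by
    have := Nat.ceil_lt_add_one (by linarith : (0 : ℝ) ≤ 8 * D)
    linarith
  have hT8 : 8 ≤ T := by
    have : (8 : ℝ) ≤ T := by linarith
    exact_mod_cast this
  have h18w : 18 * D ≤ n := by
    calc 18 * D ≤ w ^ 5 * w ^ 12 := by
          gcongr
          calc (18 : ℝ) ≤ 2 ^ 5 := by norm_num
            _ ≤ w ^ 5 := by gcongr
      _ = w ^ 17 := by ring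
      _ ≤ w ^ 10000 := pow_le_pow_right₀ hw1 (by norm_num)
      _ = n := hw
  have h2T : 2 * T ≤ n := by
    have : (2 * T : ℝ) ≤ n := by linarith
    exact_mod_cast this
  set k := n / (2 * T) with hk
  have hk1 : 1 ≤ k := Nat.div_pos h2T (by omega)
  have hkT : k * (2 * T) ≤ n := Nat.div_mul_le_self _ _
  have hkT' : n + 1 ≤ 2 * T * (k + 1) := Nat.lt_mul_div_succ n (by omega)
  have hk16 : 16 * k ≤ n := by nlinarith
  have hkD : (16 * D) * k ≤ n := by
    have : (k * (2 * T) : ℝ) ≤ n := by exact_mod_cast hkT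
    have hk0 : (0 : ℝ) ≤ k := Nat.cast_nonneg k
    nlinarith
  have hnk : (n : ℝ) + 1 ≤ 36 * D * k := by
    have h1 : (n : ℝ) + 1 ≤ 2 * T * (k + 1) := by exact_mod_cast hkT'
    have h2 : (1 : ℝ) ≤ k := by exact_mod_cast hk1
    calc (n : ℝ) + 1 ≤ 2 * T * (k + 1) := h1
      _ ≤ 2 * (9 * D) * (k + k) := by gcongr
      _ = _ := by ring
  -- As `625 = 10000 / 16`, this is `n ^ (k / 16)` rounded down, the budget for expanding the high
  -- factors.
  set b := ⌊w ^ (625 * k)⌋₊ with hb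
  have hb1 : 1 ≤ b := by
    rw [hb, Nat.one_le_floor_iff]
    exact one_le_pow₀ hw1
  have hor : ∀ x ∈ Ds, 8 * ((k + 1) * x) ≤ n + 1 ∨ C.size ^ ((n + 1) / x) ≤ b := by
    intro x hx
    rcases havoid x hx with h | h
    · left
      have h1 : (8 * ((k + 1) * x) : ℝ) ≤ n := by
        have h2 : (1 : ℝ) ≤ k := by exact_mod_cast hk1
        calc (8 * ((k + 1) * x) : ℝ) ≤ 8 * ((k + k) * D) := by gcongr
          _ = 16 * D * k := by ring
          _ ≤ n := hkD
      have h3 : 8 * ((k + 1) * x) ≤ n := by exact_mod_cast h1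
      omega
    · right
      rw [hb, Nat.le_floor_iff (by positivity)]
      push_cast
      set q := (n + 1) / x with hq
      have hx0 : (0 : ℝ) < x := lt_trans (by positivity) h
      have hqx : (q : ℝ) * x ≤ n + 1 := by exact_mod_cast Nat.div_mul_le_self (n + 1) x
      have hqν : ν * q * 16 ≤ k := by
        have h1 : (q : ℝ) * (ν ^ 12 * D) ≤ 36 * D * k := by
          calc (q : ℝ) * (ν ^ 12 * D) ≤ q * x := by
                gcongr
                rw [hD, ← pow_succ']
                exact h.le
            _ ≤ n + 1 := hqx
            _ ≤ _ := hnk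
        have h2 : (q : ℝ) * ν ^ 12 ≤ 36 * k := by
          refine le_of_mul_le_mul_right ?_ (by linarith : (0 : ℝ) < D)
          linarith
        have h3 : (2 : ℝ) ^ 11 ≤ ν ^ 11 := by gcongr
        have h4 : (2048 : ℝ) * (q * ν) ≤ 36 * k := by
          calc (2048 : ℝ) * (q * ν) = 2 ^ 11 * (q * ν) := by norm_num
            _ ≤ ν ^ 11 * (q * ν) := by gcongr
            _ = q * ν ^ 12 := by ring
            _ ≤ _ := h2
        have h5 : 0 ≤ (q : ℝ) * ν := by positivity
        nlinarith
      calc (C.size : ℝ) ^ q ≤ ((n : ℝ) ^ ν) ^ q := by gcongr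
        _ = (w ^ (10000 : ℝ)) ^ (ν * q) := by
            rw [← Real.rpow_natCast, ← Real.rpow_mul hn0.le, ← hw]
            norm_cast
        _ = w ^ (10000 * (ν * q)) := by rw [← Real.rpow_mul hw0.le]
        _ ≤ w ^ ((625 * k : ℕ) : ℝ) := by
            refine Real.rpow_le_rpow_of_exponent_le hw1 ?_
            push_cast
            linarith
        _ = _ := Real.rpow_natCast _ _
  have hsmall := hder (k + 1) (3 * n / 8) b hb1 (by omega) (by omega) hor
  rw [hval] at hsmall
  have hTn : T - 1 < Fintype.card K := by omega
  have hkt : Fintype.card K / (2 * ((⟨T - 1, hTn⟩ : Fin (Fintype.card K)) + 1)) = k := by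
    simp only [hnK, hk]
    rw [Nat.sub_add_cancel (by omega)]
  have hfinal := pow_le_of_derivsInSmallIdeal F ⟨T - 1, hTn⟩ hnK hkt hk1 (by omega) hsmall
  have hchoose : ((n + 1).choose (k + 1) : ℝ) ≤ w ^ (60 * k) := by
    have h1 : ((n + 1).choose (k + 1) : ℝ) ≤ (3 * (2 * T)) ^ (k + 1) :=
      choose_le_exp_pow (n + 1) (k + 1) (by exact_mod_cast hkT')
    have h2 : (3 * (2 * T) : ℝ) ≤ w ^ 30 := by
      calc (3 * (2 * T) : ℝ) ≤ 54 * D := by linarith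
        _ ≤ w ^ 6 * w ^ 12 := by
            gcongr
            calc (54 : ℝ) ≤ 2 ^ 6 := by norm_num
              _ ≤ w ^ 6 := by gcongr
        _ = w ^ 18 := by ring
        _ ≤ w ^ 30 := pow_le_pow_right₀ hw1 (by norm_num)
    calc ((n + 1).choose (k + 1) : ℝ) ≤ (3 * (2 * T)) ^ (k + 1) := h1
      _ ≤ (w ^ 30) ^ (k + 1) := by gcongr
      _ = w ^ (30 * (k + 1)) := by rw [pow_mul]
      _ ≤ w ^ (60 * k) := pow_le_pow_right₀ hw1 (by omega)
  have hbw : (b : ℝ) ≤ w ^ (625 * k) := Nat.floor_le (by positivity)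
  have hB : ((C.topFanIn * (b * (n + 1).choose (k + 1)) : ℕ) : ℝ) ≤ w ^ (1000 * k) := by
    push_cast
    calc (C.topFanIn : ℝ) * (b * (n + 1).choose (k + 1)) ≤ w * (w ^ (625 * k) * w ^ (60 * k)) := by
          gcongr
          exact le_trans (by exact_mod_cast hfan) hrw
      _ = w ^ (1 + (625 * k + 60 * k)) := by rw [pow_add, pow_add, pow_one]
      _ ≤ _ := pow_le_pow_right₀ hw1 (by omega)
  -- The number of generators is at most `n ^ (k / 10)`, so its fourth power, even multiplied by
  -- `128 ≤ w ^ 7`, stays below `n ^ k`.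
  have hcontra : w ^ (10000 * k) ≤ w ^ (7 + 4000 * k) := by
    calc w ^ (10000 * k) = (n : ℝ) ^ k := by rw [pow_mul, hw]
      _ ≤ 128 * ((C.topFanIn * (b * (n + 1).choose (k + 1)) : ℕ) : ℝ) ^ 4 := hfinal
      _ ≤ w ^ 7 * (w ^ (1000 * k)) ^ 4 := by
          gcongr
          calc (128 : ℝ) = 2 ^ 7 := by norm_num
            _ ≤ w ^ 7 := by gcongr
      _ = _ := by rw [← pow_mul, ← pow_add]; ring_nf
  have := (pow_le_pow_iff_right₀ (by linarith : 1 < w)).mp hcontra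
  omega

/-- The claimed bound is `n ^ ν` with `ν = n ^ (c / r)`. For `ν ≤ 2` counting variables suffices;
otherwise the derivative argument applies. -/
theorem exp_le_size (F : Type u) [Field F] {K : Type v} [Field K] [Fintype K] {n r : ℕ}
    (hnK : Fintype.card K = n) (hr : 1 ≤ r) (C : SPSPCircuit F (NWVar K)) (hC : C.IsHomogeneous)
    (hfan : C.topFanIn ≤ r) (hval : C.val = NWPoly F K) :
    Real.exp ((n : ℝ) ^ ((10000 : ℝ)⁻¹ / r) * Real.log n) ≤ C.size := by
  have hn : 1 ≤ n := hnK ▸ Fintype.card_pos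
  have hn0 : (0 : ℝ) < n := by exact_mod_cast hn
  have hn1 : (1 : ℝ) ≤ n := by exact_mod_cast hn
  rw [mul_comm, ← Real.rpow_def_of_pos hn0]
  set ν := (n : ℝ) ^ ((10000 : ℝ)⁻¹ / r) with hν
  rcases le_or_gt ν 2 with h | h
  · have hvars : C.val.vars = Finset.univ := by rw [hval, vars_nwPoly]
    have h1 := C.card_le_size_of_vars_val hvars
    have h2 : Fintype.card (NWVar K) = n ^ 2 + n := by simp [sq, hnK]
    calc (n : ℝ) ^ ν ≤ (n : ℝ) ^ (2 : ℝ) := Real.rpow_le_rpow_of_exponent_le hn1 h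
      _ = ((n ^ 2 : ℕ) : ℝ) := by norm_cast
      _ ≤ C.size := by exact_mod_cast (by omega : n ^ 2 ≤ C.size)
  · refine rpow_le_size_of_two_lt F hnK (w := (n : ℝ) ^ ((10000 : ℕ) : ℝ)⁻¹)
      (natCast_eq_rpow_pow 10000 (by norm_num)) h ?_ hr C hC hfan hval
    have hr0 : (r : ℝ) ≠ 0 := by exact_mod_cast (by omega : r ≠ 0)
    rw [hν, ← Real.rpow_natCast, ← Real.rpow_mul hn0.le, div_mul_cancel₀ _ hr0]
    norm_num

/-- A top fan-in of `o(log n)` forces superpolynomial size. -/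
theorem eventually_pow_lt_of_isLittleO_log {c : ℝ} (hc : 0 < c) {r : ℕ → ℕ}
    (hr : (fun n : ℕ => (r n : ℝ)) =o[atTop] (fun n : ℕ => Real.log (n : ℝ))) (k : ℕ) :
    ∀ᶠ n : ℕ in atTop, ((n : ℝ) ^ k) <
      Real.exp ((n : ℝ) ^ (c / ((max (r n) 1 : ℕ) : ℝ)) * Real.log n) := by
  have hlog : Tendsto (fun n : ℕ => Real.log (n : ℝ)) atTop atTop :=
    Real.tendsto_log_atTop.comp tendsto_natCast_atTop_atTop
  set L := Real.log (k + 2) with hL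
  have hL0 : 0 < L := Real.log_pos (by have : (0 : ℝ) ≤ k := Nat.cast_nonneg k; linarith)
  filter_upwards [hr.bound (div_pos hc hL0), hlog.eventually_ge_atTop (L / c),
    hlog.eventually_gt_atTop 0, eventually_ge_atTop 1] with n h1 h2 h3 h4
  have hn0 : (0 : ℝ) < n := by exact_mod_cast h4
  set R : ℝ := ((max (r n) 1 : ℕ) : ℝ) with hR
  have hR1 : 1 ≤ R := by
    rw [hR]
    exact_mod_cast le_max_right (r n) 1
  have hRle : R * L ≤ c * Real.log n := by
    rw [Real.norm_of_nonneg (Nat.cast_nonneg _), Real.norm_of_nonneg h3.le, div_mul_eq_mul_div,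
      le_div_iff₀ hL0] at h1
    rw [div_le_iff₀ hc] at h2
    rcases le_total (r n) 1 with h | h
    · rw [hR, max_eq_right h]
      push_cast
      linarith
    · rw [hR, max_eq_left h]
      exact h1
  -- Taking logarithms, this is `R * log (k + 2) ≤ c * log n`, which is where `r = o(log n)` enters.
  have hpow : (k : ℝ) + 2 ≤ (n : ℝ) ^ (c / R) := by
    rw [Real.rpow_def_of_pos hn0, ← Real.exp_log (by positivity : (0 : ℝ) < k + 2)]
    refine Real.exp_le_exp.mpr ?_
    rw [mul_div_assoc', le_div_iff₀ (by linarith)]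
    linarith
  rw [← Real.rpow_natCast, Real.rpow_def_of_pos hn0]
  refine Real.exp_lt_exp.mpr ?_
  rw [mul_comm]
  exact mul_lt_mul_of_pos_right (by linarith) h3

/-! ### Building straight-line programs -/

section Extends

open MvPolynomial

variable {F : Type u} [Field F] {σ : Type v}

/-- Every straight-line program computing `A` can be extended by at most `c` gates to one that also
computes `B`. -/
def Extends (A : Set (MvPolynomial σ F)) (c : ℕ) (B : Set (MvPolynomial σ F)) : Prop :=
  ∀ l : List (MvPolynomial σ F), StraightLine l → (∀ p ∈ A, p ∈ l) →
    ∃ l', StraightLine l' ∧ l ⊆ l' ∧ (∀ p ∈ B, p ∈ l') ∧ l'.length ≤ l.length + c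

namespace Extends

variable {A B D : Set (MvPolynomial σ F)} {c d : ℕ} {p q : MvPolynomial σ F}

theorem of_subset (h : B ⊆ A) : Extends A 0 B :=
  fun l hl hA => ⟨l, hl, List.Subset.refl l, fun p hp => hA p (h hp), le_rfl⟩

theorem of_mem (h : p ∈ A) : Extends A 0 {p} := of_subset (Set.singleton_subset_iff.mpr h)

theorem mono (h : Extends A c B) (hcd : c ≤ d) : Extends A d B := by
  intro l hl hA
  obtain ⟨l', h1, h2, h3, h4⟩ := h l hl hA
  exact ⟨l', h1, h2, h3, by omega⟩

theorem trans (h : Extends A c B) (h' : Extends B d D) : Extends A (c + d) D := by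
  intro l hl hA
  obtain ⟨l', h1, h2, h3, h4⟩ := h l hl hA
  obtain ⟨l'', g1, g2, g3, g4⟩ := h' l' h1 h3
  exact ⟨l'', g1, List.Subset.trans h2 g2, g3, by omega⟩

theorem union (h : Extends A c B) (h' : Extends A d D) : Extends A (c + d) (B ∪ D) := by
  intro l hl hA
  obtain ⟨l', h1, h2, h3, h4⟩ := h l hl hA
  obtain ⟨l'', g1, g2, g3, g4⟩ := h' l' h1 fun p hp => h2 (hA p hp)
  refine ⟨l'', g1, List.Subset.trans h2 g2, ?_, by omega⟩
  rintro p (hp | hp)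
  · exact g2 (h3 p hp)
  · exact g3 p hp

theorem biUnion {ι : Type*} (I : Finset ι) (f : ι → MvPolynomial σ F)
    (h : ∀ i ∈ I, Extends A c {f i}) : Extends A (I.card * c) (f '' I) := by
  classical
  induction I using Finset.induction_on with
  | empty => simpa using of_subset (Set.empty_subset A)
  | insert i I hi ih =>
    have h1 := (h i (Finset.mem_insert_self i I)).union
      (ih fun j hj => h j (Finset.mem_insert_of_mem hj))
    rw [Finset.card_insert_of_notMem hi, Finset.coe_insert, Set.image_insert_eq, Set.insert_eq]
    exact h1.mono (by ring_nf; rfl)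

theorem X_mem (x : σ) : Extends A 1 {(X x : MvPolynomial σ F)} :=
  fun l hl _ => ⟨X x :: l, hl.var x, List.subset_cons_self _ _, by simp, by simp⟩

theorem C_mem (a : F) : Extends A 1 {(C a : MvPolynomial σ F)} :=
  fun l hl _ => ⟨C a :: l, hl.const a, List.subset_cons_self _ _, by simp, by simp⟩

theorem add (hp : Extends A c {p}) (hq : Extends A d {q}) : Extends A (c + d + 1) {p + q} := by
  intro l hl hA
  obtain ⟨l', h1, h2, h3, h4⟩ := hp.union hq l hl hA
  exact ⟨(p + q) :: l', h1.add (h3 p (by simp)) (h3 q (by simp)),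
    List.Subset.trans h2 (List.subset_cons_self _ _), by simp, by rw [List.length_cons]; omega⟩

theorem mul (hp : Extends A c {p}) (hq : Extends A d {q}) : Extends A (c + d + 1) {p * q} := by
  intro l hl hA
  obtain ⟨l', h1, h2, h3, h4⟩ := hp.union hq l hl hA
  exact ⟨(p * q) :: l', h1.mul (h3 p (by simp)) (h3 q (by simp)),
    List.Subset.trans h2 (List.subset_cons_self _ _), by simp, by rw [List.length_cons]; omega⟩

theorem one_sub (hp : Extends A c {p}) : Extends A (c + 4) {1 - p} := by
  have h := (C_mem (A := A) (1 : F)).add ((C_mem (A := A) (-1 : F)).mul hp)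
  have e : C (1 : F) + C (-1) * p = 1 - p := by rw [C_neg, C_1]; ring
  rw [e] at h
  exact h.mono (by omega)

theorem sum {ι : Type*} (I : Finset ι) {N : ℕ} (hN : I.card ≤ N) (f : ι → MvPolynomial σ F)
    (h : ∀ i ∈ I, Extends A c {f i}) : Extends A (N * (c + 1) + 1) {∑ i ∈ I, f i} := by
  classical
  have key : Extends A (I.card * (c + 1) + 1) {∑ i ∈ I, f i} := by
    clear hN
    induction I using Finset.induction_on with
    | empty => simpa using C_mem (A := A) (0 : F)
    | insert i I hi ih =>
      rw [Finset.sum_insert hi, Finset.card_insert_of_notMem hi]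
      refine ((h i (Finset.mem_insert_self i I)).add
        (ih fun j hj => h j (Finset.mem_insert_of_mem hj))).mono (le_of_eq (by ring))
  exact key.mono (by gcongr)

theorem prod {ι : Type*} (I : Finset ι) {N : ℕ} (hN : I.card ≤ N) (f : ι → MvPolynomial σ F)
    (h : ∀ i ∈ I, Extends A c {f i}) : Extends A (N * (c + 1) + 1) {∏ i ∈ I, f i} := by
  classical
  have key : Extends A (I.card * (c + 1) + 1) {∏ i ∈ I, f i} := by
    clear hN
    induction I using Finset.induction_on with
    | empty => simpa using C_mem (A := A) (1 : F)
    | insert i I hi ih =>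
      rw [Finset.prod_insert hi, Finset.card_insert_of_notMem hi]
      refine ((h i (Finset.mem_insert_self i I)).mul
        (ih fun j hj => h j (Finset.mem_insert_of_mem hj))).mono (le_of_eq (by ring))
  exact key.mono (by gcongr)

theorem hasCircuitOfSize (h : Extends ∅ c {p}) : HasCircuitOfSize p c := by
  obtain ⟨l, h1, -, h3, h4⟩ := h [] StraightLine.nil (by simp)
  exact ⟨l, h1, h3 p rfl, by simpa using h4⟩

end Extends

end Extends

/-! ### The verifier for the Nisan–Wigderson polynomial -/

section Verifier

open scoped Classical

variable {K : Type v} [Fintype K] {R : Type w} [CommRing R]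

/-- On Boolean values, this is `1` if exactly one of the values `V` is `1`, and `0` otherwise. -/
def oneHot (V : K → R) : R := ∑ a : K, V a * ∏ a' ∈ Finset.univ.erase a, (1 - V a')

theorem oneHot_of_indicator (x : K) : oneHot (fun a => if a = x then (1 : R) else 0) = 1 := by
  rw [oneHot, Finset.sum_eq_single x]
  · rw [if_pos rfl, one_mul]
    refine Finset.prod_eq_one fun a ha => ?_
    rw [if_neg (Finset.ne_of_mem_erase ha), sub_zero]
  · intro a _ ha
    rw [if_neg ha, zero_mul]
  · exact fun h => absurd (Finset.mem_univ x) h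

theorem exists_indicator_of_oneHot_ne_zero {β : K → Bool}
    (h : oneHot (fun a => if β a then (1 : R) else 0) ≠ 0) :
    ∃ x, ∀ a, β a = decide (a = x) := by
  obtain ⟨x, -, hx⟩ := Finset.exists_ne_zero_of_sum_ne_zero h
  refine ⟨x, fun a => ?_⟩
  have h1 := left_ne_zero_of_mul hx
  have h2 := right_ne_zero_of_mul hx
  by_cases ha : a = x
  · subst ha
    by_contra hb
    simp at hb
    simp [hb] at h1
  · by_contra hb
    simp [ha] at hb
    exact h2 (Finset.prod_eq_zero (Finset.mem_erase.mpr ⟨ha, Finset.mem_univ a⟩) (by simp [hb]))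

variable [Field K]

/-- If `W c` is the indicator of `α c`, then `hornerIndicator W i c` is the indicator of
`∑_{j < c} α j * i ^ j`. -/
def hornerIndicator (W : ℕ → K → R) (i : K) : ℕ → K → R
  | 0, v => if v = 0 then 1 else 0
  | c + 1, v => ∑ a : K, W c a * hornerIndicator W i c (v - a * i ^ c)

/-- The summand of the Nisan–Wigderson polynomial, with the coefficients of a polynomial given by
the indicators `W`. -/
def nwTerm (W : ℕ → K → R) (Y : Fin (Fintype.card K) → R) (Z : K → K → R) : R :=
  (∑ t, Y t * ∏ c ∈ (Finset.range (Fintype.card K)).filter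
    (fun c => Fintype.card K / (2 * (t + 1)) ≤ c), W c 0) *
  ∏ i : K, ∑ v : K, hornerIndicator W i (Fintype.card K) v * Z i v

/-- `nwTerm` guarded by the test that `W` consists of indicators. -/
def nwVerifier (W : ℕ → K → R) (Y : Fin (Fintype.card K) → R) (Z : K → K → R) : R :=
  (∏ c ∈ Finset.range (Fintype.card K), oneHot (W c)) * nwTerm W Y Z

variable {S : Type*} [CommRing S] (φ : R →+* S)

theorem map_hornerIndicator (W : ℕ → K → R) (i : K) (c : ℕ) (v : K) :
    φ (hornerIndicator W i c v) = hornerIndicator (fun c a => φ (W c a)) i c v := by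
  induction c generalizing v with
  | zero =>
    simp only [hornerIndicator]
    split_ifs <;> simp
  | succ c ih => simp [hornerIndicator, ih]

theorem map_nwVerifier (W : ℕ → K → R) (Y : Fin (Fintype.card K) → R) (Z : K → K → R) :
    φ (nwVerifier W Y Z) =
      nwVerifier (fun c a => φ (W c a)) (fun t => φ (Y t)) (fun i v => φ (Z i v)) := by
  simp [nwVerifier, nwTerm, oneHot, map_hornerIndicator]

theorem hornerIndicator_of_indicator {W : ℕ → K → R} {α : ℕ → K} {n : ℕ}
    (h : ∀ c < n, ∀ a, W c a = if a = α c then 1 else 0) (i : K) {c : ℕ} (hc : c ≤ n) (v : K) :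
    hornerIndicator W i c v = if v = ∑ j ∈ Finset.range c, α j * i ^ j then 1 else 0 := by
  induction c generalizing v with
  | zero =>
    simp only [hornerIndicator, Finset.range_zero, Finset.sum_empty]
    by_cases hv : v = 0 <;> simp [hv]
  | succ c ih =>
    simp only [hornerIndicator]
    simp_rw [h c (by omega), ih (by omega), ite_mul, one_mul, zero_mul]
    rw [Finset.sum_ite_eq' Finset.univ (α c), if_pos (Finset.mem_univ _), Finset.sum_range_succ]
    simp only [sub_eq_iff_eq_add]

/-- The factors `W c 0` with `c ≥ ⌊n/(2t)⌋` test the degree bound, so a single tuple of `n`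
coefficients serves all `t` at once. -/
theorem nwTerm_of_indicator {W : ℕ → K → R} {α : ℕ → K}
    (h : ∀ c < Fintype.card K, ∀ a, W c a = if a = α c then 1 else 0)
    (Y : Fin (Fintype.card K) → R) (Z : K → K → R) :
    nwTerm W Y Z = ∑ t : Fin (Fintype.card K), if ∀ c < Fintype.card K, Fintype.card K / (2 * (t + 1)) ≤ c → α c = 0 then
      Y t * ∏ i, Z i (∑ j ∈ Finset.range (Fintype.card K), α j * i ^ j) else 0 := by
  rw [nwTerm, Finset.sum_mul]
  refine Finset.sum_congr rfl fun t _ => ?_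
  have h1 : ∀ i : K, ∑ v : K, hornerIndicator W i (Fintype.card K) v * Z i v =
      Z i (∑ j ∈ Finset.range (Fintype.card K), α j * i ^ j) := by
    intro i
    simp_rw [hornerIndicator_of_indicator h i le_rfl, ite_mul, one_mul, zero_mul]
    rw [Finset.sum_ite_eq' Finset.univ, if_pos (Finset.mem_univ _)]
  simp_rw [h1]
  split_ifs with hc
  · rw [Finset.prod_eq_one, mul_one]
    intro c hc'
    rw [Finset.mem_filter, Finset.mem_range] at hc'
    rw [h c hc'.1, if_pos (hc c hc'.1 hc'.2).symm]
  · push Not at hc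
    obtain ⟨c, hc1, hc2, hc3⟩ := hc
    rw [Finset.prod_eq_zero (i := c), mul_zero, zero_mul]
    · exact Finset.mem_filter.mpr ⟨Finset.mem_range.mpr hc1, hc2⟩
    · rw [h c hc1, if_neg (Ne.symm hc3)]

end Verifier

/-! ### Summing the verifier over all witnesses -/

section Witness

open MvPolynomial
open scoped Classical

variable (F : Type u) [Field F] {K : Type v} [Field K] [Fintype K]

/-- A tuple of coefficients, continued by zero. -/
def extendCoeff {K : Type v} [Field K] {n : ℕ} (α : Fin n → K) (c : ℕ) : K := if h : c < n then α ⟨c, h⟩ else 0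

theorem extendCoeff_val {K : Type v} [Field K] {n : ℕ} (α : Fin n → K) (c : Fin n) : extendCoeff α c = α c := by
  rw [extendCoeff, dif_pos c.2]

theorem sum_coeff_eq_sum_designSet (t : ℕ) (Z : K → K → MvPolynomial (NWVar K) F) :
    (∑ α : Fin (Fintype.card K) → K,
      if ∀ c < Fintype.card K, Fintype.card K / (2 * t) ≤ c → extendCoeff α c = 0 then
        ∏ i, Z i (∑ j ∈ Finset.range (Fintype.card K), extendCoeff α j * i ^ j) else 0) =
      ∑ f ∈ designSet K t, ∏ i, Z i (f.eval i) := by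
  set n := Fintype.card K
  have hcoeff : ∀ α : Fin n → K, ∀ c,
      (∑ j ∈ Finset.range n, Polynomial.monomial j (extendCoeff α j)).coeff c = extendCoeff α c := by
    intro α c
    rw [Polynomial.finsetSum_coeff]
    simp only [Polynomial.coeff_monomial]
    rw [Finset.sum_ite_eq' (Finset.range n) c]
    split_ifs with hc
    · rfl
    · rw [extendCoeff, dif_neg (by simpa using hc)]
  have hext : ∀ f ∈ designSet K t, ∀ c, extendCoeff (fun c : Fin n => f.coeff c) c = f.coeff c := by
    intro f hf c
    rw [extendCoeff]
    split_ifs with hc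
    · rfl
    · rw [mem_designSet, Polynomial.degree_lt_iff_coeff_zero] at hf
      exact (hf c ((Nat.div_le_self _ _).trans (not_lt.mp hc))).symm
  rw [← Finset.sum_filter]
  refine Finset.sum_nbij' (fun α => ∑ j ∈ Finset.range n, Polynomial.monomial j (extendCoeff α j))
    (fun f c => f.coeff c) ?_ ?_ ?_ ?_ ?_
  · intro α hα
    rw [Finset.mem_filter] at hα
    rw [mem_designSet, Polynomial.degree_lt_iff_coeff_zero]
    intro c hc
    rw [hcoeff]
    by_cases hcn : c < n
    · exact hα.2 c hcn hc
    · rw [extendCoeff, dif_neg hcn]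
  · intro f hf
    rw [Finset.mem_filter]
    refine ⟨Finset.mem_univ _, fun c _ hc => ?_⟩
    rw [hext f hf]
    rw [mem_designSet, Polynomial.degree_lt_iff_coeff_zero] at hf
    exact hf c hc
  · intro α _
    funext c
    rw [hcoeff, extendCoeff, dif_pos c.2]
  · intro f hf
    ext c
    rw [hcoeff, hext f hf]
  · intro α _
    refine Finset.prod_congr rfl fun i _ => ?_
    rw [Polynomial.eval_finsetSum]
    simp only [Polynomial.eval_monomial]

/-- The position of the bit that says that coefficient `c` is `a`. -/
def bitIndex (c : ℕ) (a : K) : Fin (Fintype.card K * Fintype.card K) :=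
  finProdFinEquiv (⟨c % Fintype.card K, Nat.mod_lt _ Fintype.card_pos⟩, Fintype.equivFin K a)

/-- The verifier as a polynomial in the variables of `NWPoly` and the bits. -/
def nwVerifierPoly (K : Type v) [Field K] [Fintype K] :
    MvPolynomial (NWVar K ⊕ Fin (Fintype.card K * Fintype.card K)) F :=
  nwVerifier (fun c a => X (Sum.inr (bitIndex c a))) (fun t => X (Sum.inl (Sum.inr t)))
    (fun i v : K => X (Sum.inl (Sum.inl (i, v))))

/-- The bits that encode a tuple of coefficients. -/
def encodeBits (α : Fin (Fintype.card K) → K) (p : Fin (Fintype.card K * Fintype.card K)) : Bool :=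
  decide ((Fintype.equivFin K).symm (finProdFinEquiv.symm p).2 = α (finProdFinEquiv.symm p).1)

theorem encodeBits_bitIndex (α : Fin (Fintype.card K) → K) {c : ℕ} (hc : c < Fintype.card K)
    (a : K) : encodeBits α (bitIndex c a) = decide (a = extendCoeff α c) := by
  simp [encodeBits, bitIndex, extendCoeff, hc, Nat.mod_eq_of_lt hc]

theorem nwPoly_eq_sum_verifier :
    NWPoly F K = ∑ b : Fin (Fintype.card K * Fintype.card K) → Bool,
      aeval (Sum.elim X (fun j => if b j then 1 else 0)) (nwVerifierPoly F K) := by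
  set n := Fintype.card K with hn
  have hmap : ∀ b : Fin (n * n) → Bool,
      aeval (Sum.elim X (fun j => if b j then 1 else 0)) (nwVerifierPoly F K) =
        nwVerifier (fun c a => if b (bitIndex c a) then 1 else 0)
          (fun t => (X (Sum.inr t) : MvPolynomial (NWVar K) F))
          (fun i v : K => X (Sum.inl (i, v))) := by
    intro b
    have := map_nwVerifier (K := K) (aeval (Sum.elim X (fun j => if b j then 1 else 0)) :
      MvPolynomial (NWVar K ⊕ Fin (n * n)) F →ₐ[F] MvPolynomial (NWVar K) F).toRingHom
      (fun c a => X (Sum.inr (bitIndex c a))) (fun t => X (Sum.inl (Sum.inr t)))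
      (fun i v : K => X (Sum.inl (Sum.inl (i, v))))
    simpa [nwVerifierPoly] using this
  have hind : ∀ α : Fin n → K, ∀ c < n, ∀ a : K,
      (if encodeBits α (bitIndex c a) then (1 : MvPolynomial (NWVar K) F) else 0) =
        if a = extendCoeff α c then 1 else 0 := by
    intro α c hc a
    rw [encodeBits_bitIndex α hc]
    simp
  symm
  calc _ = ∑ b : Fin (n * n) → Bool, nwVerifier (fun c a => if b (bitIndex c a) then 1 else 0)
          (fun t => (X (Sum.inr t) : MvPolynomial (NWVar K) F))
          (fun i v : K => X (Sum.inl (i, v))) := Finset.sum_congr rfl fun b _ => hmap b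
    _ = ∑ α : Fin n → K, nwTerm (fun c a => if encodeBits α (bitIndex c a) then 1 else 0)
          (fun t => (X (Sum.inr t) : MvPolynomial (NWVar K) F))
          (fun i v : K => X (Sum.inl (i, v))) := by
        symm
        refine Finset.sum_of_injOn encodeBits ?_ (fun _ _ => Finset.mem_coe.mpr (Finset.mem_univ _)) ?_ ?_
        · intro α _ α' _ h
          funext c
          have h1 := encodeBits_bitIndex α c.2 (α c)
          rw [h, encodeBits_bitIndex α' c.2] at h1
          rw [extendCoeff_val, extendCoeff_val] at h1
          simpa using h1
        · intro b _ hb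
          -- A bit string that encodes no coefficient tuple fails some one-hot test and contributes
          -- `0`.
          rw [nwVerifier]
          have : ∏ c ∈ Finset.range n, oneHot (fun a : K =>
              if b (bitIndex c a) then (1 : MvPolynomial (NWVar K) F) else 0) = 0 := by
            by_contra hne
            replace hne := Finset.prod_ne_zero_iff.mp hne
            have hex : ∀ c : Fin n, ∃ x, ∀ a, b (bitIndex c a) = decide (a = x) := fun c =>
              exists_indicator_of_oneHot_ne_zero (hne c (Finset.mem_range.mpr c.2))
            choose α hα using hex
            refine hb ⟨α, Finset.mem_coe.mpr (Finset.mem_univ _), ?_⟩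
            funext p
            obtain ⟨⟨c, a⟩, rfl⟩ := finProdFinEquiv.surjective p
            have hp : finProdFinEquiv (c, a) = bitIndex c ((Fintype.equivFin K).symm a) := by
              simp [bitIndex, Nat.mod_eq_of_lt c.2]
            rw [hp, hα c, encodeBits_bitIndex α c.2]
            simp [extendCoeff]
          rw [this, zero_mul]
        · intro α _
          rw [nwVerifier, Finset.prod_eq_one, one_mul]
          intro c hc
          simp_rw [hind α c (Finset.mem_range.mp hc)]
          exact oneHot_of_indicator _
    _ = ∑ α : Fin n → K, ∑ t : Fin n,
          if ∀ c < n, n / (2 * (t + 1)) ≤ c → extendCoeff α c = 0 then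
          X (Sum.inr t) * ∏ i : K, (X (Sum.inl (i,
            ∑ j ∈ Finset.range n, extendCoeff α j * i ^ j)) : MvPolynomial (NWVar K) F) else 0 :=
        Finset.sum_congr rfl fun α _ => nwTerm_of_indicator (hind α) _ _
    _ = NWPoly F K := by
        rw [Finset.sum_comm, NWPoly]
        refine Finset.sum_congr rfl fun t _ => ?_
        rw [nwDesign_eq_sum, ← sum_coeff_eq_sum_designSet F _ fun i v => X (Sum.inl (i, v)),
          Finset.mul_sum]
        simp_rw [mul_ite, mul_zero]
        rfl

end Witness

/-! ### Circuit size and degree of the verifier -/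

section VerifierSize

open MvPolynomial
open scoped Classical

variable {F : Type u} [Field F] {τ : Type w} {K : Type v} [Fintype K]

theorem extends_oneHot {A : Set (MvPolynomial τ F)} {V : K → MvPolynomial τ F}
    (hV : ∀ a, Extends A 1 {V a}) :
    Extends A (Fintype.card K * (6 * Fintype.card K + 4) + 1) {oneHot V} := by
  refine (Extends.sum Finset.univ (N := Fintype.card K) le_rfl _ fun a _ =>
    (hV a).mul (Extends.prod (Finset.univ.erase a) (N := Fintype.card K)
      (Finset.card_le_univ _) _ fun a' _ => (hV a').one_sub)).mono (le_of_eq (by ring))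

theorem totalDegree_finsetProd_le_mul {ι : Type*} (s : Finset ι) {f : ι → MvPolynomial τ F}
    {N d : ℕ} (hN : s.card ≤ N) (h : ∀ i ∈ s, (f i).totalDegree ≤ d) :
    (∏ i ∈ s, f i).totalDegree ≤ N * d := by
  refine (totalDegree_finsetProd s f).trans ((Finset.sum_le_sum h).trans ?_)
  rw [Finset.sum_const, smul_eq_mul]
  exact Nat.mul_le_mul_right d hN

theorem totalDegree_oneHot_le {V : K → MvPolynomial τ F} (hV : ∀ a, (V a).totalDegree ≤ 1) :
    (oneHot V).totalDegree ≤ Fintype.card K + 1 := by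
  refine totalDegree_finsetSum_le fun a _ => (totalDegree_mul _ _).trans ?_
  have h1 := hV a
  have h2 := totalDegree_finsetProd_le_mul (N := Fintype.card K) (d := 1) (Finset.univ.erase a)
    (f := fun a' => 1 - V a') (Finset.card_le_univ _) fun a' _ =>
      (totalDegree_sub _ _).trans (max_le (by simp) (hV a'))
  omega

variable [Field K]

/-- The whole table over all pairs `(i, v)` is built level by level. Sharing the previous level
keeps the cost polynomial, whereas unfolding the recursion would be exponential. -/
theorem extends_hornerIndicator {W : ℕ → K → MvPolynomial τ F}
    (hW : ∀ c a, Extends (∅ : Set (MvPolynomial τ F)) 1 {W c a}) (c : ℕ) :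
    Extends (∅ : Set (MvPolynomial τ F))
      (Fintype.card K ^ 2 + c * (Fintype.card K ^ 2 * (3 * Fintype.card K + 1)))
      ((fun iv : K × K => hornerIndicator W iv.1 c iv.2) '' (Finset.univ : Finset (K × K))) := by
  have hcard : (Finset.univ : Finset (K × K)).card = Fintype.card K ^ 2 := by simp [sq]
  induction c with
  | zero =>
    refine (Extends.biUnion (c := 1) Finset.univ _ fun iv _ => ?_).mono (by rw [hcard]; omega)
    simp only [hornerIndicator]
    split_ifs
    · simpa using Extends.C_mem (A := (∅ : Set (MvPolynomial τ F))) (1 : F)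
    · simpa using Extends.C_mem (A := (∅ : Set (MvPolynomial τ F))) (0 : F)
  | succ c ih =>
    refine (ih.trans (Extends.biUnion (c := 3 * Fintype.card K + 1) Finset.univ _
      fun iv _ => ?_)).mono (by rw [hcard]; exact le_of_eq (by ring))
    simp only [hornerIndicator]
    refine (Extends.sum Finset.univ (N := Fintype.card K) le_rfl _ fun a _ =>
      Extends.mul (c := 1) ?_ (Extends.of_mem ?_)).mono (le_of_eq (by ring))
    · intro l hl _
      exact hW c a l hl (by simp)
    · exact ⟨(iv.1, iv.2 - a * iv.1 ^ c), by simp, rfl⟩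

theorem extends_nwVerifier {W : ℕ → K → MvPolynomial τ F}
    {Y : Fin (Fintype.card K) → MvPolynomial τ F} {Z : K → K → MvPolynomial τ F}
    (hW : ∀ A c a, Extends A 1 {W c a}) (hY : ∀ A t, Extends A 1 {Y t})
    (hZ : ∀ A i v, Extends A 1 {Z i v}) :
    Extends (∅ : Set (MvPolynomial τ F)) (33 * Fintype.card K ^ 4) {nwVerifier W Y Z} := by
  have hn1 : 1 ≤ Fintype.card K := Fintype.card_pos
  refine ((extends_hornerIndicator (hW ∅) (Fintype.card K)).trans (Extends.mul
    (Extends.prod (Finset.range (Fintype.card K)) (N := Fintype.card K) (by simp) _ fun c _ => extends_oneHot (hW _ c))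
    (Extends.mul
      (Extends.sum Finset.univ (N := Fintype.card K) (by simp) _ fun t _ => (hY _ t).mul
        (Extends.prod _ (N := Fintype.card K) ((Finset.card_filter_le _ _).trans (by simp)) _
          fun c _ => hW _ c 0))
      (Extends.prod Finset.univ (N := Fintype.card K) le_rfl _ fun i _ =>
        Extends.sum Finset.univ (N := Fintype.card K) le_rfl _ fun v _ =>
          (Extends.of_mem (Set.mem_image_of_mem
            (fun iv : K × K => hornerIndicator W iv.1 (Fintype.card K) iv.2)
            (Finset.mem_coe.mpr (Finset.mem_univ (i, v))))).mul (hZ _ i v))))).mono ?_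
  generalize Fintype.card K = n at hn1 ⊢
  have h2 : n ^ 2 ≤ n ^ 4 := Nat.pow_le_pow_right hn1 (by norm_num)
  have h3 : n ^ 3 ≤ n ^ 4 := Nat.pow_le_pow_right hn1 (by norm_num)
  have h1 : n ≤ n ^ 4 := Nat.le_self_pow (by norm_num) n
  have h0 : 1 ≤ n ^ 4 := Nat.one_le_pow _ _ hn1
  ring_nf at *
  omega

theorem totalDegree_hornerIndicator_le {W : ℕ → K → MvPolynomial τ F}
    (hW : ∀ c a, (W c a).totalDegree ≤ 1) (i : K) (c : ℕ) (v : K) :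
    (hornerIndicator W i c v).totalDegree ≤ c := by
  induction c generalizing v with
  | zero =>
    simp only [hornerIndicator]
    split_ifs <;> simp
  | succ c ih =>
    simp only [hornerIndicator]
    refine totalDegree_finsetSum_le fun a _ => (totalDegree_mul _ _).trans ?_
    have h1 := hW c a
    have h2 := ih (v - a * i ^ c)
    omega

theorem totalDegree_nwVerifier_le {W : ℕ → K → MvPolynomial τ F}
    {Y : Fin (Fintype.card K) → MvPolynomial τ F} {Z : K → K → MvPolynomial τ F}
    (hW : ∀ c a, (W c a).totalDegree ≤ 1) (hY : ∀ t, (Y t).totalDegree ≤ 1)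
    (hZ : ∀ i v, (Z i v).totalDegree ≤ 1) :
    (nwVerifier W Y Z).totalDegree ≤ 6 * Fintype.card K ^ 2 := by
  have hn1 : 1 ≤ Fintype.card K := Fintype.card_pos
  have h1 := totalDegree_finsetProd_le_mul (N := Fintype.card K) (Finset.range (Fintype.card K)) (f := fun c => oneHot (W c))
    (by simp) fun c _ => totalDegree_oneHot_le (hW c)
  have h2 : (∑ t, Y t * ∏ c ∈ (Finset.range (Fintype.card K)).filter
      (fun c => Fintype.card K / (2 * ((t : Fin (Fintype.card K)) + 1)) ≤ c), W c 0).totalDegree ≤ 1 + Fintype.card K := by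
    refine totalDegree_finsetSum_le fun t _ => (totalDegree_mul _ _).trans ?_
    have h3 := totalDegree_finsetProd_le_mul (N := Fintype.card K) (d := 1) ((Finset.range (Fintype.card K)).filter
      (fun c => Fintype.card K / (2 * ((t : Fin (Fintype.card K)) + 1)) ≤ c)) (f := fun c => W c 0)
      ((Finset.card_filter_le _ _).trans (by simp)) fun c _ => hW c 0
    have := hY t
    omega
  have h3 := totalDegree_finsetProd_le_mul (N := Fintype.card K) (d := Fintype.card K + 1) (Finset.univ : Finset K)
    (f := fun i => ∑ v : K, hornerIndicator W i (Fintype.card K) v * Z i v) le_rfl fun i _ =>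
      totalDegree_finsetSum_le fun v _ => (totalDegree_mul _ _).trans
        (add_le_add (totalDegree_hornerIndicator_le hW i _ v) (hZ i v))
  have h4 := totalDegree_mul (∏ c ∈ Finset.range (Fintype.card K), oneHot (W c)) (nwTerm W Y Z)
  have h5 := totalDegree_mul (∑ t, Y t * ∏ c ∈ (Finset.range (Fintype.card K)).filter
      (fun c => Fintype.card K / (2 * ((t : Fin (Fintype.card K)) + 1)) ≤ c), W c 0)
    (∏ i : K, ∑ v : K, hornerIndicator W i (Fintype.card K) v * Z i v)
  have h6 : (nwVerifier W Y Z).totalDegree ≤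
      Fintype.card K * (Fintype.card K + 1) +
        (1 + Fintype.card K + Fintype.card K * (Fintype.card K + 1)) :=
    h4.trans (add_le_add h1 (h5.trans (add_le_add h2 h3)))
  nlinarith

end VerifierSize

/-! ### Membership in `VNP` -/

open MvPolynomial in
theorem inVNP_nwPoly {ι : Type*} (len : ι → ℕ) (F : Type u) [Field F] (K : ι → Type v)
    [∀ n, Field (K n)] [∀ n, Fintype (K n)] (hK : ∀ n, Fintype.card (K n) = len n) :
    InVNP len (fun n => NWPoly F (K n)) := by
  -- The exponent `10` suffices since `33 * q ^ 4 ≤ 2 ^ 6 * q ^ 4 ≤ q ^ 10` for `q ≥ 2`.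
  refine ⟨10, fun n => Fintype.card (K n) * Fintype.card (K n), fun n => nwVerifierPoly F (K n),
    fun n => ?_⟩
  rw [← hK n]
  have hq : 2 ≤ Fintype.card (K n) := Fintype.one_lt_card
  have hdeg : (nwVerifierPoly F (K n)).totalDegree ≤ 6 * Fintype.card (K n) ^ 2 :=
    totalDegree_nwVerifier_le (fun c a => (totalDegree_X _).le) (fun t => (totalDegree_X _).le)
      fun i v => (totalDegree_X _).le
  have hsize : HasCircuitOfSize (nwVerifierPoly F (K n)) (33 * Fintype.card (K n) ^ 4) :=
    (extends_nwVerifier (fun _ _ _ => Extends.X_mem _) (fun _ _ => Extends.X_mem _)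
      fun _ _ _ => Extends.X_mem _).hasCircuitOfSize
  have hcard : Fintype.card (NWVar (K n)) = Fintype.card (K n) ^ 2 + Fintype.card (K n) := by
    simp [sq]
  have htot := totalDegree_nwPoly F (K := K n)
  have harith : ∀ q : ℕ, 2 ≤ q → q ^ 2 + q ≤ q ^ 10 + 10 ∧ 6 * q ^ 2 ≤ q ^ 10 + 10 ∧
      33 * q ^ 4 ≤ q ^ 10 + 10 := by
    intro q hq
    have h4 : 64 * q ^ 4 ≤ q ^ 10 := by
      calc 64 * q ^ 4 = 2 ^ 6 * q ^ 4 := by norm_num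
        _ ≤ q ^ 6 * q ^ 4 := by gcongr
        _ = q ^ 10 := by ring
    have h2 : q ^ 2 ≤ q ^ 4 := Nat.pow_le_pow_right (by omega) (by norm_num)
    have h1 : q ≤ q ^ 2 := Nat.le_self_pow (by norm_num) q
    omega
  obtain ⟨h1, h2, h3⟩ := harith _ hq
  refine ⟨hcard.trans_le h1, htot.trans_le (le_trans ?_ h1), le_trans ?_ h1, hdeg.trans h2, ?_,
    nwPoly_eq_sum_verifier F⟩
  · nlinarith
  · simp only [sq]
    omega
  · obtain ⟨l, hl1, hl2, hl3⟩ := hsize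
    exact ⟨l, hl1, hl2, hl3.trans h3⟩

end

/-! ### The theorem -/

theorem theorem3 :
    ∃ c : ℝ, 0 < c ∧
      ∀ (F : Type u) [Field F] (𝕂 : {n : ℕ // IsPrimePow n} → Type v)
        [∀ n, Field (𝕂 n)] [∀ n, Fintype (𝕂 n)], (∀ n, Fintype.card (𝕂 n) = n.val) →
        InVNP (fun n : {n : ℕ // IsPrimePow n} => n.val) (fun n => NWPoly F (𝕂 n)) ∧
        (∀ n, (NWPoly F (𝕂 n)).totalDegree = n.val + 1 ∧
          (NWPoly F (𝕂 n)).vars.card = n.val ^ 2 + n.val) ∧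
        (∀ (n : {n : ℕ // IsPrimePow n}) (r : ℕ), 1 ≤ r →
          ∀ C : SPSPCircuit F (NWVar (𝕂 n)), C.IsHomogeneous → C.topFanIn ≤ r →
            C.val = NWPoly F (𝕂 n) →
            Real.exp ((n.val : ℝ) ^ (c / (r : ℝ)) * Real.log (n.val : ℝ)) ≤ (C.size : ℝ)) ∧
        (∀ r : ℕ → ℕ,
          (fun n : ℕ => (r n : ℝ)) =o[atTop] (fun n : ℕ => Real.log (n : ℝ)) →
          ∀ k : ℕ, ∃ n₀ : ℕ, ∀ n : {n : ℕ // IsPrimePow n}, n₀ ≤ n.val →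
            ∀ C : SPSPCircuit F (NWVar (𝕂 n)), C.IsHomogeneous → C.topFanIn ≤ r n.val →
              C.val = NWPoly F (𝕂 n) → n.val ^ k < C.size) := by
  refine ⟨(10000 : ℝ)⁻¹, by norm_num, fun F _ 𝕂 _ _ h𝕂 => ⟨inVNP_nwPoly _ F 𝕂 h𝕂,
    fun n => ⟨?_, ?_⟩, fun n r hr C hC hfan hval => exp_le_size F (h𝕂 n) hr C hC hfan hval,
    fun r hr k => ?_⟩⟩
  · rw [totalDegree_nwPoly, h𝕂]
  · rw [vars_nwPoly, Finset.card_univ]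
    simp [sq, h𝕂]
  · obtain ⟨n₀, hn₀⟩ := eventually_atTop.mp
      (eventually_pow_lt_of_isLittleO_log (by norm_num : (0 : ℝ) < (10000 : ℝ)⁻¹) hr k)
    refine ⟨n₀, fun n hn C hC hfan hval => ?_⟩
    have h1 := hn₀ n.val hn
    -- The value `r n = 0` is possible; replacing it by `1` only weakens the restriction on the
    -- circuit.
    have h2 := exp_le_size F (h𝕂 n) (le_max_right (r n.val) 1) C hC
      (hfan.trans (le_max_left _ _)) hval
    exact_mod_cast h1.trans_le h2
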